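/- **Theorem.** Let $d\ge 1$, let $\Omega\subset\mathbb R^d$ be open and bounded, and let $\nu:\mathbb R^d\setminus\{0\}\to[0,\infty]$ be measurable with $\nu(h)=\nu(-h)$ for all $h\neq 0$, $$\int_{\mathbb R^d}(1\wedge|h|^2)\,\nu(h)\,dh<\infty\qquad\text{and}\qquad \int_{\mathbb R^d}\nu(h)\,dh=\infty .$$ For open $U\subset\mathbb R^d$ let $H_\nu(U)=\{u\in L^2(U):\ \|u\|_{H_\nu(U)}<\infty\}$, where $$\|u\|_{H_\nu(U)}^2=\|u\|_{L^2(U)}^2+\iint_{U\times U}(u(x)-u(y))^2\,\nu(x-y)\,dx\,dy,$$ and let $V_\nu(\Omega|\mathbb R^d)$ be the space of measurable $u:\mathbb R^d\to\mathbb R$ with $u|_\Omega\in L^2(\Omega)$ and $\|u\|_{V_\nu(\Omega|\mathbb R^d)}<\infty$, with the (semi)norm $$\|u\|_{V_\nu(\Omega|\mathbb R^d)}^2=\|u\|_{L^2(\Omega)}^2+\iint_{\Omega\times\mathbb R^d}(u(x)-u(y))^2\,\nu(x-y)\,dx\,dy.$$ Suppose that at least one of the following three conditions holds. * ($\mathscr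 A_1$) There are a map $E:H_\nu(\Omega)\to H_\nu(\mathbb R^d)$ and a constant $C>0$ with $Eu|_\Omega=u$ and $\|Eu\|_{H_\nu(\mathbb R^d)}\le C\|u\|_{H_\nu(\Omega)}$ for every $u\in H_\nu(\Omega)$. * ($\mathscr A_2$) $\Omega$ has a Lipschitz boundary (near each boundary point, in suitable orthonormal coordinates, $\Omega$ is the region strictly above the graph of a Lipschitz function), $\nu$ is radial, and $q(\delta):=\delta^{-2}\int_{B_\delta(0)}|h|^2\nu(h)\,dh\to\infty$ as $\delta\to0^+$. * ($\mathscr A_3$) $\widetilde q(\delta):=\inf_{a\in\partial\Omega}\int_{\Omega_\delta}\nu(h-a)\,dh\to\infty$ as $\delta\to0^+$, where $\Omega_\delta=\{x\in\Omega:\operatorname{dist}(x,\partial\Omega)>\delta\}$. Then the embedding $H_\nu(\Omega)\hookrightarrow L^2(\Omega)$ is compact, and the embedding $V_\nu(\Omega|\mathbb R^d)\hookrightarrow L^2(\Omega)$, $u\mapsto u|_\Omega$, is compact. -/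

import Mathlib

open MeasureTheory Filter Topology
open scoped ENNReal NNReal

namespace Nonlocal

/-- The space `ℝ^d` with its Euclidean norm and Lebesgue measure `volume`. -/
abbrev Rd (d : ℕ) := EuclideanSpace ℝ (Fin d)

variable {d : ℕ}

/-- The measure `ν(x - y) dx dy` on `A × B`. -/
noncomputable def jumpMeasure (ν : Rd d → ℝ≥0∞) (A B : Set (Rd d)) : Measure (Rd d × Rd d) :=
  (((volume : Measure (Rd d)).restrict A).prod ((volume : Measure (Rd d)).restrict B)).withDensity
    (fun p => ν (p.1 - p.2))

/-- The energy `∬_{A × B} (u(x) - u(y))² ν(x - y) dx dy`, a number in `[0, ∞]`. -/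
noncomputable def energy (ν : Rd d → ℝ≥0∞) (A B : Set (Rd d)) (u : Rd d → ℝ) : ℝ≥0∞ :=
  ∫⁻ p, ENNReal.ofReal ((u p.1 - u p.2) ^ 2) ∂(jumpMeasure ν A B)

/-- The number `(‖u‖²_{L²(Ω)} + ∬_{Ω × B} (u(x) - u(y))² ν(x - y) dx dy)^{1/2}`, for `u` such that
both terms are finite. -/
noncomputable def nlNorm (ν : Rd d → ℝ≥0∞) (Ω B : Set (Rd d)) (u : Rd d → ℝ) : ℝ :=
  Real.sqrt ((eLpNorm u 2 (volume.restrict Ω)).toReal ^ 2 + (energy ν Ω B u).toReal)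

/-! Elementary facts on the energy, needed for the vector space and norm structures below. -/

theorem energy_eq (ν : Rd d → ℝ≥0∞) (A B : Set (Rd d)) (u : Rd d → ℝ) :
    energy ν A B u = (eLpNorm (fun p : Rd d × Rd d => u p.1 - u p.2) 2 (jumpMeasure ν A B)) ^ 2 := by
  rw [eLpNorm_eq_lintegral_rpow_enorm_toReal (by norm_num) (by norm_num), ← ENNReal.rpow_natCast,
    ← ENNReal.rpow_mul]
  norm_num [energy]
  refine lintegral_congr fun p => ?_
  rw [← ofReal_norm, ← ENNReal.ofReal_pow (norm_nonneg _), Real.norm_eq_abs, sq_abs]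

theorem fst_quasi (ν : Rd d → ℝ≥0∞) (A B : Set (Rd d)) :
    Measure.QuasiMeasurePreserving Prod.fst (jumpMeasure ν A B) (volume.restrict A) :=
  Measure.quasiMeasurePreserving_fst.mono_left (withDensity_absolutelyContinuous _ _)

theorem snd_quasi (ν : Rd d → ℝ≥0∞) (A B : Set (Rd d)) :
    Measure.QuasiMeasurePreserving Prod.snd (jumpMeasure ν A B) (volume.restrict B) :=
  Measure.quasiMeasurePreserving_snd.mono_left (withDensity_absolutelyContinuous _ _)

theorem aesm_diff {ν : Rd d → ℝ≥0∞} {A B : Set (Rd d)} {u : Rd d → ℝ}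
    (hA : AEStronglyMeasurable u (volume.restrict A))
    (hB : AEStronglyMeasurable u (volume.restrict B)) :
    AEStronglyMeasurable (fun p : Rd d × Rd d => u p.1 - u p.2) (jumpMeasure ν A B) :=
  (hA.comp_quasiMeasurePreserving (fst_quasi ν A B)).sub
    (hB.comp_quasiMeasurePreserving (snd_quasi ν A B))

theorem energy_congr {ν : Rd d → ℝ≥0∞} {A B : Set (Rd d)} {u v : Rd d → ℝ}
    (hA : u =ᵐ[volume.restrict A] v) (hB : u =ᵐ[volume.restrict B] v) :
    energy ν A B u = energy ν A B v := by
  refine lintegral_congr_ae ?_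
  filter_upwards [(fst_quasi ν A B).ae_eq_comp hA, (snd_quasi ν A B).ae_eq_comp hB] with p h1 h2
  simp only [Function.comp] at h1 h2
  rw [h1, h2]

theorem nlNorm_congr {ν : Rd d → ℝ≥0∞} {Ω B : Set (Rd d)} {u v : Rd d → ℝ}
    (hA : u =ᵐ[volume.restrict Ω] v) (hB : u =ᵐ[volume.restrict B] v) :
    nlNorm ν Ω B u = nlNorm ν Ω B v := by
  rw [nlNorm, nlNorm, energy_congr hA hB, eLpNorm_congr_ae hA]

theorem energy_zero (ν : Rd d → ℝ≥0∞) (A B : Set (Rd d)) : energy ν A B 0 = 0 := by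
  simp [energy]

theorem energy_smul (ν : Rd d → ℝ≥0∞) (A B : Set (Rd d)) (c : ℝ) (u : Rd d → ℝ) :
    energy ν A B (c • u) = ENNReal.ofReal (c ^ 2) * energy ν A B u := by
  rw [energy, energy, ← lintegral_const_mul' _ _ ENNReal.ofReal_ne_top]
  refine lintegral_congr fun p => ?_
  rw [← ENNReal.ofReal_mul (sq_nonneg c)]
  congr 1
  simp only [Pi.smul_apply, smul_eq_mul]
  ring

theorem eLpNorm_diff_add {ν : Rd d → ℝ≥0∞} {A B : Set (Rd d)} {u v : Rd d → ℝ}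
    (huA : AEStronglyMeasurable u (volume.restrict A))
    (huB : AEStronglyMeasurable u (volume.restrict B))
    (hvA : AEStronglyMeasurable v (volume.restrict A))
    (hvB : AEStronglyMeasurable v (volume.restrict B)) :
    eLpNorm (fun p : Rd d × Rd d => (u + v) p.1 - (u + v) p.2) 2 (jumpMeasure ν A B) ≤
      eLpNorm (fun p : Rd d × Rd d => u p.1 - u p.2) 2 (jumpMeasure ν A B) +
      eLpNorm (fun p : Rd d × Rd d => v p.1 - v p.2) 2 (jumpMeasure ν A B) := by
  have h : (fun p : Rd d × Rd d => (u + v) p.1 - (u + v) p.2) =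
      (fun p : Rd d × Rd d => u p.1 - u p.2) + (fun p : Rd d × Rd d => v p.1 - v p.2) := by
    funext p
    simp only [Pi.add_apply]
    ring
  rw [h]
  exact eLpNorm_add_le (aesm_diff huA huB) (aesm_diff hvA hvB) (by norm_num)

theorem eLpNorm_diff_lt_top {ν : Rd d → ℝ≥0∞} {A B : Set (Rd d)} {u : Rd d → ℝ}
    (hu : energy ν A B u < ∞) :
    eLpNorm (fun p : Rd d × Rd d => u p.1 - u p.2) 2 (jumpMeasure ν A B) < ∞ := by
  rw [energy_eq] at hu
  by_contra h
  rw [not_lt, top_le_iff] at h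
  simp [h] at hu

theorem energy_add_lt_top {ν : Rd d → ℝ≥0∞} {A B : Set (Rd d)} {u v : Rd d → ℝ}
    (huA : AEStronglyMeasurable u (volume.restrict A))
    (huB : AEStronglyMeasurable u (volume.restrict B))
    (hvA : AEStronglyMeasurable v (volume.restrict A))
    (hvB : AEStronglyMeasurable v (volume.restrict B))
    (hu : energy ν A B u < ∞) (hv : energy ν A B v < ∞) : energy ν A B (u + v) < ∞ := by
  rw [energy_eq]
  exact ENNReal.pow_lt_top ((eLpNorm_diff_add huA huB hvA hvB).trans_lt
    (ENNReal.add_lt_top.2 ⟨eLpNorm_diff_lt_top hu, eLpNorm_diff_lt_top hv⟩))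

theorem energy_smul_lt_top {ν : Rd d → ℝ≥0∞} {A B : Set (Rd d)} {u : Rd d → ℝ} (c : ℝ)
    (hu : energy ν A B u < ∞) : energy ν A B (c • u) < ∞ := by
  rw [energy_smul]
  exact ENNReal.mul_lt_top ENNReal.ofReal_lt_top hu

theorem sqrt_add_le (a b a' b' : ℝ) :
    Real.sqrt ((a + a') ^ 2 + (b + b') ^ 2) ≤
      Real.sqrt (a ^ 2 + b ^ 2) + Real.sqrt (a' ^ 2 + b' ^ 2) := by
  have h := norm_add_le (!₂[a, b] : EuclideanSpace ℝ (Fin 2)) !₂[a', b']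
  simpa [EuclideanSpace.norm_eq, Fin.sum_univ_two] using h

theorem nlNorm_zero (ν : Rd d → ℝ≥0∞) (Ω B : Set (Rd d)) : nlNorm ν Ω B 0 = 0 := by
  simp [nlNorm, energy_zero]

theorem nlNorm_smul (ν : Rd d → ℝ≥0∞) (Ω B : Set (Rd d)) (c : ℝ) (u : Rd d → ℝ) :
    nlNorm ν Ω B (c • u) = ‖c‖ * nlNorm ν Ω B u := by
  rw [nlNorm, nlNorm, energy_smul, eLpNorm_const_smul, ENNReal.toReal_mul, ENNReal.toReal_mul,
    ENNReal.toReal_ofReal (sq_nonneg c), toReal_enorm, mul_pow, Real.norm_eq_abs, sq_abs, ← mul_add,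
    Real.sqrt_mul (sq_nonneg c), Real.sqrt_sq_eq_abs]

theorem nlNorm_neg (ν : Rd d → ℝ≥0∞) (Ω B : Set (Rd d)) (u : Rd d → ℝ) :
    nlNorm ν Ω B (-u) = nlNorm ν Ω B u := by
  simpa using nlNorm_smul ν Ω B (-1) u

theorem nlNorm_add_le {ν : Rd d → ℝ≥0∞} {Ω B : Set (Rd d)} {u v : Rd d → ℝ}
    (hu2 : MemLp u 2 (volume.restrict Ω)) (hv2 : MemLp v 2 (volume.restrict Ω))
    (huB : AEStronglyMeasurable u (volume.restrict B))
    (hvB : AEStronglyMeasurable v (volume.restrict B))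
    (hu : energy ν Ω B u < ∞) (hv : energy ν Ω B v < ∞) :
    nlNorm ν Ω B (u + v) ≤ nlNorm ν Ω B u + nlNorm ν Ω B v := by
  simp only [nlNorm, energy_eq, ENNReal.toReal_pow]
  refine le_trans (Real.sqrt_le_sqrt ?_) (sqrt_add_le _ _ _ _)
  have h1 := ENNReal.toReal_mono (ENNReal.add_lt_top.2 ⟨hu2.2, hv2.2⟩).ne
    (eLpNorm_add_le hu2.1 hv2.1 (by norm_num))
  have h2 := ENNReal.toReal_mono
    (ENNReal.add_lt_top.2 ⟨eLpNorm_diff_lt_top hu, eLpNorm_diff_lt_top hv⟩).ne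
    (eLpNorm_diff_add hu2.1 huB hv2.1 hvB)
  rw [ENNReal.toReal_add hu2.2.ne hv2.2.ne] at h1
  rw [ENNReal.toReal_add (eLpNorm_diff_lt_top hu).ne (eLpNorm_diff_lt_top hv).ne] at h2
  exact add_le_add (pow_le_pow_left₀ ENNReal.toReal_nonneg h1 2)
    (pow_le_pow_left₀ ENNReal.toReal_nonneg h2 2)

theorem le_nlNorm (ν : Rd d → ℝ≥0∞) (Ω B : Set (Rd d)) (u : Rd d → ℝ) :
    (eLpNorm u 2 (volume.restrict Ω)).toReal ≤ nlNorm ν Ω B u :=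
  Real.le_sqrt_of_sq_le (le_add_of_nonneg_right ENNReal.toReal_nonneg)

/-! ### The space `H_ν(Ω)` -/

/-- `H_ν(Ω) = {u ∈ L²(Ω) : ∬_{Ω × Ω} (u(x) - u(y))² ν(x - y) dx dy < ∞}` as a subspace of
`L²(Ω)`. -/
noncomputable def HSub (ν : Rd d → ℝ≥0∞) (Ω : Set (Rd d)) :
    Submodule ℝ (Lp ℝ 2 ((volume : Measure (Rd d)).restrict Ω)) where
  carrier := {u | energy ν Ω Ω u < ∞}
  zero_mem' := by
    have h := Lp.coeFn_zero ℝ 2 ((volume : Measure (Rd d)).restrict Ω)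
    rw [Set.mem_ofPred_eq, energy_congr h h, energy_zero]
    exact ENNReal.zero_lt_top
  add_mem' := by
    intro u v hu hv
    have h := Lp.coeFn_add u v
    rw [Set.mem_ofPred_eq, energy_congr h h]
    exact energy_add_lt_top (Lp.memLp u).1 (Lp.memLp u).1 (Lp.memLp v).1 (Lp.memLp v).1 hu hv
  smul_mem' := by
    intro c u hu
    have h := Lp.coeFn_smul c u
    rw [Set.mem_ofPred_eq, energy_congr h h]
    exact energy_smul_lt_top c hu

/-- The vector space `H_ν(Ω)`. It is a type of its own, so that it carries its own norm and not
the norm of `L²(Ω)`. -/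
def H (ν : Rd d → ℝ≥0∞) (Ω : Set (Rd d)) : Type := HSub ν Ω

noncomputable instance (ν : Rd d → ℝ≥0∞) (Ω : Set (Rd d)) : AddCommGroup (H ν Ω) :=
  inferInstanceAs (AddCommGroup (HSub ν Ω))

noncomputable instance (ν : Rd d → ℝ≥0∞) (Ω : Set (Rd d)) : Module ℝ (H ν Ω) :=
  inferInstanceAs (Module ℝ (HSub ν Ω))

/-- The inclusion of `H_ν(Ω)` into `L²(Ω)`, as a linear map. -/
noncomputable def H.incl (ν : Rd d → ℝ≥0∞) (Ω : Set (Rd d)) :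
    H ν Ω →ₗ[ℝ] Lp ℝ 2 ((volume : Measure (Rd d)).restrict Ω) :=
  (HSub ν Ω).subtype

theorem H.energy_lt_top {ν : Rd d → ℝ≥0∞} {Ω : Set (Rd d)} (u : H ν Ω) :
    energy ν Ω Ω (H.incl ν Ω u) < ∞ := u.2

/-- The norm `‖u‖² = ‖u‖²_{L²(Ω)} + ∬_{Ω × Ω} (u(x) - u(y))² ν(x - y) dx dy` of `H_ν(Ω)`. -/
noncomputable instance (ν : Rd d → ℝ≥0∞) (Ω : Set (Rd d)) : Norm (H ν Ω) :=
  ⟨fun u => nlNorm ν Ω Ω (H.incl ν Ω u)⟩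

theorem H.norm_def {ν : Rd d → ℝ≥0∞} {Ω : Set (Rd d)} (u : H ν Ω) :
    ‖u‖ = nlNorm ν Ω Ω (H.incl ν Ω u) := rfl

theorem H.norm_incl_le {ν : Rd d → ℝ≥0∞} {Ω : Set (Rd d)} (u : H ν Ω) :
    ‖H.incl ν Ω u‖ ≤ ‖u‖ := le_nlNorm ν Ω Ω _

theorem H.normCore (ν : Rd d → ℝ≥0∞) (Ω : Set (Rd d)) : NormedSpace.Core ℝ (H ν Ω) where
  norm_nonneg u := Real.sqrt_nonneg _
  norm_smul c u := by
    have h := Lp.coeFn_smul c (H.incl ν Ω u)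
    rw [H.norm_def, map_smul, nlNorm_congr h h, nlNorm_smul, H.norm_def]
  norm_triangle u v := by
    have h := Lp.coeFn_add (H.incl ν Ω u) (H.incl ν Ω v)
    rw [H.norm_def, map_add, nlNorm_congr h h]
    exact nlNorm_add_le (Lp.memLp _) (Lp.memLp _) (Lp.memLp _).1 (Lp.memLp _).1 u.energy_lt_top
      v.energy_lt_top
  norm_eq_zero_iff u := by
    constructor
    · intro h
      have h1 : H.incl ν Ω u = 0 := norm_le_zero_iff.1 (h ▸ H.norm_incl_le u)
      exact Subtype.ext h1
    · rintro rfl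
      have h := Lp.coeFn_zero ℝ 2 ((volume : Measure (Rd d)).restrict Ω)
      rw [H.norm_def, map_zero, nlNorm_congr h h, nlNorm_zero]

noncomputable instance (ν : Rd d → ℝ≥0∞) (Ω : Set (Rd d)) : NormedAddCommGroup (H ν Ω) :=
  NormedAddCommGroup.ofCore (H.normCore ν Ω)

noncomputable instance (ν : Rd d → ℝ≥0∞) (Ω : Set (Rd d)) : NormedSpace ℝ (H ν Ω) :=
  NormedSpace.ofCore (H.normCore ν Ω)

/-- The embedding `H_ν(Ω) ↪ L²(Ω)`. -/
noncomputable def H.embedding (ν : Rd d → ℝ≥0∞) (Ω : Set (Rd d)) :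
    H ν Ω →L[ℝ] Lp ℝ 2 ((volume : Measure (Rd d)).restrict Ω) :=
  (H.incl ν Ω).mkContinuous 1 (fun u => by rw [one_mul]; exact H.norm_incl_le u)

/-! ### The space `V_ν(Ω|ℝ^d)` -/

/-- `V_ν(Ω|ℝ^d)`: the (Lebesgue) measurable functions `u : ℝ^d → ℝ` with `u|_Ω ∈ L²(Ω)` and
`∬_{Ω × ℝ^d} (u(x) - u(y))² ν(x - y) dx dy < ∞`. -/
def VSub (ν : Rd d → ℝ≥0∞) (Ω : Set (Rd d)) : Submodule ℝ (Rd d → ℝ) where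
  carrier := {u | AEStronglyMeasurable u volume ∧ MemLp u 2 (volume.restrict Ω) ∧
    energy ν Ω Set.univ u < ∞}
  zero_mem' := ⟨aestronglyMeasurable_zero, MemLp.zero, by
    rw [energy_zero]
    exact ENNReal.zero_lt_top⟩
  add_mem' := by
    rintro u v ⟨hu1, hu2, hu3⟩ ⟨hv1, hv2, hv3⟩
    exact ⟨hu1.add hv1, hu2.add hv2,
      energy_add_lt_top hu2.1 hu1.restrict hv2.1 hv1.restrict hu3 hv3⟩
  smul_mem' := by
    rintro c u ⟨hu1, hu2, hu3⟩
    exact ⟨hu1.const_smul c, hu2.const_smul c, energy_smul_lt_top c hu3⟩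

/-- The vector space `V_ν(Ω|ℝ^d)`. -/
def V (ν : Rd d → ℝ≥0∞) (Ω : Set (Rd d)) : Type := VSub ν Ω

noncomputable instance (ν : Rd d → ℝ≥0∞) (Ω : Set (Rd d)) : AddCommGroup (V ν Ω) :=
  inferInstanceAs (AddCommGroup (VSub ν Ω))

noncomputable instance (ν : Rd d → ℝ≥0∞) (Ω : Set (Rd d)) : Module ℝ (V ν Ω) :=
  inferInstanceAs (Module ℝ (VSub ν Ω))

/-- An element of `V_ν(Ω|ℝ^d)` as a function. -/
def V.toFun (ν : Rd d → ℝ≥0∞) (Ω : Set (Rd d)) : V ν Ω →ₗ[ℝ] (Rd d → ℝ) := (VSub ν Ω).subtype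

theorem V.mem {ν : Rd d → ℝ≥0∞} {Ω : Set (Rd d)} (u : V ν Ω) :
    AEStronglyMeasurable (V.toFun ν Ω u) volume ∧
      MemLp (V.toFun ν Ω u) 2 (volume.restrict Ω) ∧
      energy ν Ω Set.univ (V.toFun ν Ω u) < ∞ := u.2

/-- The norm `‖u‖² = ‖u‖²_{L²(Ω)} + ∬_{Ω × ℝ^d} (u(x) - u(y))² ν(x - y) dx dy` of
`V_ν(Ω|ℝ^d)`; in general it is only a seminorm. -/
noncomputable instance (ν : Rd d → ℝ≥0∞) (Ω : Set (Rd d)) : Norm (V ν Ω) :=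
  ⟨fun u => nlNorm ν Ω Set.univ (V.toFun ν Ω u)⟩

theorem V.norm_def {ν : Rd d → ℝ≥0∞} {Ω : Set (Rd d)} (u : V ν Ω) :
    ‖u‖ = nlNorm ν Ω Set.univ (V.toFun ν Ω u) := rfl

theorem V.normCore (ν : Rd d → ℝ≥0∞) (Ω : Set (Rd d)) : SeminormedSpace.Core ℝ (V ν Ω) where
  norm_nonneg u := Real.sqrt_nonneg _
  norm_smul c u := by rw [V.norm_def, map_smul, nlNorm_smul, V.norm_def]
  norm_triangle u v := by
    rw [V.norm_def, map_add]
    exact nlNorm_add_le u.mem.2.1 v.mem.2.1 u.mem.1.restrict v.mem.1.restrict u.mem.2.2 v.mem.2.2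

noncomputable instance (ν : Rd d → ℝ≥0∞) (Ω : Set (Rd d)) : SeminormedAddCommGroup (V ν Ω) :=
  SeminormedAddCommGroup.ofCore (V.normCore ν Ω)

noncomputable instance (ν : Rd d → ℝ≥0∞) (Ω : Set (Rd d)) : NormedSpace ℝ (V ν Ω) where
  norm_smul_le c u := ((V.normCore ν Ω).norm_smul c u).le

/-- The embedding `V_ν(Ω|ℝ^d) ↪ L²(Ω)`, that is `u ↦ u|_Ω`. -/
noncomputable def V.embedding (ν : Rd d → ℝ≥0∞) (Ω : Set (Rd d)) :
    V ν Ω →L[ℝ] Lp ℝ 2 ((volume : Measure (Rd d)).restrict Ω) :=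
  LinearMap.mkContinuous
    { toFun := fun u => u.mem.2.1.toLp (V.toFun ν Ω u)
      map_add' := fun u v => MemLp.toLp_add u.mem.2.1 v.mem.2.1
      map_smul' := fun c u => MemLp.toLp_const_smul c u.mem.2.1 } 1
    (fun u => by
      rw [one_mul]
      exact (Lp.norm_toLp _ u.mem.2.1).trans_le (le_nlNorm ν Ω Set.univ _))

/-! ### Conditions on `ν` and `Ω` -/

/-- `ν` is the density of a symmetric Lévy measure which is infinite: `ν` is measurable,
`ν(h) = ν(-h)`, `∫ (1 ∧ |h|²) ν(h) dh < ∞` and `∫ ν(h) dh = ∞`.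
The value of `ν` at `0` plays no role. -/
structure IsSingularLevyDensity (ν : Rd d → ℝ≥0∞) : Prop where
  aemeasurable : AEMeasurable ν volume
  symm : ∀ h : Rd d, h ≠ 0 → ν (-h) = ν h
  levy : ∫⁻ h, min 1 (ENNReal.ofReal (‖h‖ ^ 2)) * ν h < ∞
  nonintegrable : ∫⁻ h, ν h = ∞

/-- `ν` is radial. -/
def IsRadial (ν : Rd d → ℝ≥0∞) : Prop :=
  ∀ x y : Rd d, x ≠ 0 → ‖x‖ = ‖y‖ → ν x = ν y

/-- `Ω` has a Lipschitz boundary: near every boundary point `Ω` is, in suitable orthonormal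
coordinates `x ↦ (x', t)` with `t = ⟪e, x⟫` and `x' = x - t e ∈ e^⊥`, the region
`{t > γ(x')}` strictly above the graph of a Lipschitz function `γ`
(only the values of `γ` on `e^⊥` matter). -/
def HasLipschitzBoundary (Ω : Set (Rd d)) : Prop :=
  ∀ a ∈ frontier Ω, ∃ r : ℝ, 0 < r ∧ ∃ e : Rd d, ‖e‖ = 1 ∧ ∃ (K : ℝ≥0) (γ : Rd d → ℝ),
    LipschitzWith K γ ∧
      ∀ x ∈ Metric.ball a r, x ∈ Ω ↔ γ (x - inner ℝ e x • e) < inner ℝ e x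

/-- `Ω_δ = {x ∈ Ω : dist(x, ∂Ω) > δ}`. -/
def innerSet (Ω : Set (Rd d)) (δ : ℝ) : Set (Rd d) :=
  {x | x ∈ Ω ∧ δ < Metric.infDist x (frontier Ω)}

/-- `q(δ) = δ⁻² ∫_{B_δ(0)} |h|² ν(h) dh`. -/
noncomputable def q (ν : Rd d → ℝ≥0∞) (δ : ℝ) : ℝ≥0∞ :=
  (∫⁻ h in Metric.ball 0 δ, ENNReal.ofReal (‖h‖ ^ 2) * ν h) / ENNReal.ofReal (δ ^ 2)

/-- `q̃(δ) = inf_{a ∈ ∂Ω} ∫_{Ω_δ} ν(h - a) dh`. -/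
noncomputable def qTilde (ν : Rd d → ℝ≥0∞) (Ω : Set (Rd d)) (δ : ℝ) : ℝ≥0∞ :=
  ⨅ a ∈ frontier Ω, ∫⁻ h in innerSet Ω δ, ν (h - a)

/-- The class `A₁`: there is a bounded extension operator `H_ν(Ω) → H_ν(ℝ^d)`
(linearity is not required). -/
structure ClassA1 (ν : Rd d → ℝ≥0∞) (Ω : Set (Rd d)) : Prop extends IsSingularLevyDensity ν where
  extension : ∃ (T : H ν Ω → H ν Set.univ) (C : ℝ), 0 < C ∧ ∀ u : H ν Ω,
    ‖T u‖ ≤ C * ‖u‖ ∧ H.incl ν Set.univ (T u) =ᵐ[volume.restrict Ω] H.incl ν Ω u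

/-- The class `A₂`: `∂Ω` is Lipschitz, `ν` is radial and `q(δ) → ∞` as `δ → 0+`. -/
structure ClassA2 (ν : Rd d → ℝ≥0∞) (Ω : Set (Rd d)) : Prop extends IsSingularLevyDensity ν where
  lipschitz : HasLipschitzBoundary Ω
  radial : IsRadial ν
  tendsto_q : Tendsto (q ν) (𝓝[>] 0) (𝓝 ∞)

/-- The class `A₃`: `q̃(δ) → ∞` as `δ → 0+`. -/
structure ClassA3 (ν : Rd d → ℝ≥0∞) (Ω : Set (Rd d)) : Prop extends IsSingularLevyDensity ν where
  tendsto_qTilde : Tendsto (qTilde ν Ω) (𝓝[>] 0) (𝓝 ∞)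

end Nonlocal

namespace Nonlocal
variable {d : ℕ}

/-! It suffices to bound `∫_Ω u²` by `ε ‖u‖²` plus the square of finitely many continuous
functionals of `u`, for every `ε` (`EnergyControlled`): on the unit ball the functionals have
bounded, hence totally bounded, range, so the image of the ball in `L²(Ω)` is totally bounded.

Interior estimate (`IsSingularLevyDensity.energyControlled`). Since `ν` has infinite mass near `0`,
it dominates bounded kernels `k` of small support and arbitrarily large mass `m`. If the support of
`k(x - ·)` lies in `U`, expanding the square gives `∫ (u(x) - u(y))² k(x - y) dy ≥ m u(x)² - 2 u(x)
⟪k(x - ·), u⟫`. So `u(x)²` is at most `2/m` times a piece of the energy plus a multiple of `⟪k(x -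
·), u⟫²`. The slices `k(x - ·)` depend uniformly continuously on `x` in `L²`, so on a bounded set
finitely many of them suffice.

With an extension operator this is applied with `U = ℝ^d`. Under the other two conditions it is
applied to `innerSet Ω σ`, and the strip along the boundary is absorbed by a small multiple of the
energy plus the interior mass (`BoundaryControlled`). Under `ClassA3`, a point near `∂Ω` interacts
directly with the interior with weight about `q̃(δ)`. Under `ClassA2`, it reaches the interior by
about `δ/|h|` equal jumps `h` in a cone. These cost at most a multiple of `δ²/|h|²` times one jump,
and averaging with weight `|h|² ν(h)` produces the factor `1/q(δ)`.

The statement for `V_ν(Ω|ℝ^d)` follows by restriction to `H_ν(Ω)`. -/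

/-! ### Total boundedness and energy control. -/

/-- A bounded set in `ℝⁿ` has a finite `ε/2`-net; preimages of its points under `L` give a finite
`ε`-net for the range of `f`. -/
theorem totallyBounded_range_of_dist_le {α E : Type*} [PseudoMetricSpace E] (f : α → E)
    (h : ∀ ε : ℝ, 0 < ε → ∃ (n : ℕ) (L : α → Fin n → ℝ), Bornology.IsBounded (Set.range L) ∧
      ∀ a b, dist (f a) (f b) ≤ ε + dist (L a) (L b)) : TotallyBounded (Set.range f) := by
  rw [Metric.totallyBounded_iff]
  intro ε hε
  obtain ⟨n, L, hL, hd⟩ := h (ε / 2) (half_pos hε)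
  have htb : TotallyBounded (Set.range L) := hL.isCompact_closure.totallyBounded.subset subset_closure
  obtain ⟨t, ht, htf, hcov⟩ := Metric.finite_approx_of_totallyBounded htb (ε / 2) (half_pos hε)
  choose g hg using fun y : t => ht y.2
  have := htf.to_subtype
  refine ⟨Set.range fun y : t => f (g y), Set.finite_range _, ?_⟩
  rintro _ ⟨a, rfl⟩
  obtain ⟨y, hy, hay⟩ := Set.mem_iUnion₂.1 (hcov ⟨a, rfl⟩)
  refine Set.mem_iUnion₂.2 ⟨_, ⟨⟨y, hy⟩, rfl⟩, ?_⟩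
  have := hd a (g ⟨y, hy⟩)
  rw [hg] at this
  rw [Metric.mem_ball] at hay ⊢
  linarith

/-- The `L²(A)`-norm is controlled by an arbitrarily small multiple of the norm of `H_ν(U)` and
finitely many continuous functionals on `L²(U)`. -/
def EnergyControlled (ν : Rd d → ℝ≥0∞) (U A : Set (Rd d)) : Prop :=
  ∀ ε : ℝ≥0∞, ε ≠ 0 → ∃ (n : ℕ) (L : Lp ℝ 2 ((volume : Measure (Rd d)).restrict U) →L[ℝ] (Fin n → ℝ)),
    ∀ u : Lp ℝ 2 ((volume : Measure (Rd d)).restrict U),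
      ∫⁻ x in A, ENNReal.ofReal (u x ^ 2) ≤ ε * (energy ν U U u + ‖u‖ₑ ^ 2) + ‖L u‖ₑ ^ 2

theorem eLpNorm_two_sq {α : Type*} [MeasurableSpace α] (μ : Measure α) (u : α → ℝ) :
    eLpNorm u 2 μ ^ 2 = ∫⁻ x, ENNReal.ofReal (u x ^ 2) ∂μ := by
  rw [eLpNorm_eq_lintegral_rpow_enorm_toReal (by norm_num) (by norm_num), ← ENNReal.rpow_natCast,
    ← ENNReal.rpow_mul]
  norm_num
  refine lintegral_congr fun p => ?_
  rw [← ofReal_norm, ← ENNReal.ofReal_pow (norm_nonneg _), Real.norm_eq_abs, sq_abs]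

theorem H.enorm_sq {ν : Rd d → ℝ≥0∞} {U : Set (Rd d)} (u : H ν U) :
    energy ν U U (H.incl ν U u) + ‖H.incl ν U u‖ₑ ^ 2 = ‖u‖ₑ ^ 2 := by
  rw [← ofReal_norm, ← ENNReal.ofReal_pow (norm_nonneg _), ← ofReal_norm,
    ← ENNReal.ofReal_pow (norm_nonneg _), H.norm_def u, nlNorm, Real.sq_sqrt (by positivity),
    ENNReal.ofReal_add (by positivity) (by positivity), ENNReal.ofReal_toReal u.energy_lt_top.ne,
    add_comm, Lp.norm_def]

theorem EnergyControlled.norm_le {ν : Rd d → ℝ≥0∞} {U A : Set (Rd d)}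
    (hc : EnergyControlled ν U A) {η : ℝ} (hη : 0 < η) :
    ∃ (n : ℕ) (L : Lp ℝ 2 ((volume : Measure (Rd d)).restrict U) →L[ℝ] (Fin n → ℝ)),
      ∀ u : H ν U, (eLpNorm (H.incl ν U u) 2 (volume.restrict A)).toReal ≤
        η * ‖u‖ + ‖L (H.incl ν U u)‖ := by
  obtain ⟨n, L, hL⟩ := hc (ENNReal.ofReal η ^ 2) (by simp [hη])
  refine ⟨n, L, fun u => ?_⟩
  have h := hL (H.incl ν U u)
  rw [H.enorm_sq, ← eLpNorm_two_sq, ← mul_pow] at h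
  have h2 : eLpNorm (H.incl ν U u) 2 (volume.restrict A) ≤
      ENNReal.ofReal η * ‖u‖ₑ + ‖L (H.incl ν U u)‖ₑ := by
    rw [← ENNReal.pow_le_pow_left_iff (two_ne_zero)]
    refine h.trans ?_
    rw [add_sq]
    gcongr
    exact le_self_add
  refine (ENNReal.toReal_mono (by finiteness) h2).trans_eq ?_
  rw [ENNReal.toReal_add (by finiteness) (by finiteness), ENNReal.toReal_mul,
    ENNReal.toReal_ofReal hη.le, toReal_enorm, toReal_enorm]

/-! ### Kernels below `ν` and the interior estimate. -/

/-- A lower bound of the energy in terms of a kernel below `ν`. -/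
theorem lintegral_kernel_le_energy {ν k : Rd d → ℝ≥0∞} (hν : AEMeasurable ν volume)
    (hk : Measurable k) (hle : k ≤ᵐ[volume] ν) {U A B : Set (Rd d)} (hA : A ⊆ U) (hB : B ⊆ U)
    {u : Rd d → ℝ} (hu : Measurable u) :
    ∫⁻ x in A, ∫⁻ y in B, ENNReal.ofReal ((u x - u y) ^ 2) * k (x - y) ≤ energy ν U U u := by
  have hq : Measure.QuasiMeasurePreserving (fun p : Rd d × Rd d => p.1 - p.2)
      (((volume : Measure (Rd d)).restrict U).prod ((volume : Measure (Rd d)).restrict U))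
      volume := by
    refine (quasiMeasurePreserving_sub (volume : Measure (Rd d)) volume).mono_left ?_
    rw [Measure.prod_restrict]
    exact Measure.restrict_le_self.absolutelyContinuous
  rw [energy, jumpMeasure, lintegral_withDensity_eq_lintegral_mul₀
    (f := fun p : Rd d × Rd d => ν (p.1 - p.2)) (hν.comp_quasiMeasurePreserving hq) (by fun_prop)]
  calc ∫⁻ x in A, ∫⁻ y in B, ENNReal.ofReal ((u x - u y) ^ 2) * k (x - y)
      = ∫⁻ p, ENNReal.ofReal ((u p.1 - u p.2) ^ 2) * k (p.1 - p.2)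
          ∂((volume.restrict A).prod (volume.restrict B)) := by
        rw [lintegral_prod _ (by fun_prop)]
    _ ≤ ∫⁻ p, ENNReal.ofReal ((u p.1 - u p.2) ^ 2) * k (p.1 - p.2)
          ∂((volume.restrict U).prod (volume.restrict U)) := by
        rw [Measure.prod_restrict, Measure.prod_restrict]
        exact lintegral_mono_set (Set.prod_mono hA hB)
    _ ≤ _ := by
        refine lintegral_mono_ae ?_
        filter_upwards [hq.ae hle] with p hp
        simp only [Pi.mul_apply]
        rw [mul_comm]
        gcongr

/-- Translations are continuous in `L^p`. -/
theorem exists_eLpNorm_translate_le {p : ℝ≥0∞} (hp1 : 1 ≤ p) (hp : p ≠ ∞) {f : Rd d → ℝ}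
    (hf : MemLp f p volume) {ε : ℝ} (hε : 0 < ε) :
    ∃ ρ : ℝ, 0 < ρ ∧ ∀ z : Rd d, ‖z‖ < ρ →
      eLpNorm (fun y => f (z + y) - f y) p volume ≤ ENNReal.ofReal ε := by
  have : Fact (1 ≤ p) := ⟨hp1⟩
  have : Fact (p ≠ ∞) := ⟨hp⟩
  have hc : Continuous fun z : Rd d => (DomAddAct.mk z) +ᵥ hf.toLp f := by
    fun_prop
  have h0 := (Metric.continuous_iff.1 hc) 0 ε hε
  obtain ⟨ρ, hρ, h⟩ := h0
  refine ⟨ρ, hρ, fun z hz => ?_⟩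
  have h1 := h z (by simpa using hz)
  have e1 : (DomAddAct.mk (0 : Rd d)) +ᵥ hf.toLp f = hf.toLp f := by simp
  rw [e1, dist_eq_norm, Lp.norm_def] at h1
  have e2 : eLpNorm (fun y => f (z + y) - f y) p volume =
      eLpNorm (((DomAddAct.mk z +ᵥ hf.toLp f) - hf.toLp f : Lp ℝ p (volume : Measure (Rd d))) :
        Rd d → ℝ) p volume := by
    rw [DomAddAct.mk_vadd_toLp, ← MemLp.toLp_sub]
    simp only [vadd_eq_add]
    exact (eLpNorm_congr_ae (MemLp.coeFn_toLp _)).symm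
  rw [e2]
  exact (ENNReal.le_ofReal_iff_toReal_le (Lp.eLpNorm_ne_top _) hε.le).2 h1.le

theorem IsSingularLevyDensity.setLIntegral_compl_ball_lt_top {ν : Rd d → ℝ≥0∞}
    (hν : IsSingularLevyDensity ν) {δ : ℝ} (hδ : 0 < δ) :
    ∫⁻ h in (Metric.ball 0 δ)ᶜ, ν h < ∞ := by
  set c : ℝ≥0∞ := min 1 (ENNReal.ofReal (δ ^ 2)) with hc
  have hc0 : c ≠ 0 := by simp [hc, hδ.ne']
  have hct : c ≠ ∞ := ne_top_of_le_ne_top ENNReal.one_ne_top (min_le_left _ _)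
  have h1 : c * ∫⁻ h in (Metric.ball 0 δ)ᶜ, ν h ≤
      ∫⁻ h, min 1 (ENNReal.ofReal (‖h‖ ^ 2)) * ν h := by
    rw [← lintegral_const_mul' _ _ hct]
    refine le_trans (setLIntegral_mono' measurableSet_ball.compl fun h hh => ?_)
      (setLIntegral_le_lintegral _ _)
    have : δ ≤ ‖h‖ := by simpa using hh
    rw [hc]
    gcongr
  by_contra hcon
  rw [not_lt, top_le_iff] at hcon
  rw [hcon, ENNReal.mul_top hc0, top_le_iff] at h1
  exact hν.levy.ne h1

/-- A singular Lévy density dominates bounded kernels of arbitrarily small support and arbitrarily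
large mass. -/
theorem IsSingularLevyDensity.exists_kernel {ν : Rd d → ℝ≥0∞}
    (hν : IsSingularLevyDensity ν) {δ : ℝ} (hδ : 0 < δ) (N : ℝ≥0) :
    ∃ (k : Rd d → ℝ≥0) (c : ℝ≥0), Measurable k ∧ (∀ h, k h ≤ c) ∧
      (∀ h, h ∉ Metric.ball 0 δ → k h = 0) ∧ (fun h => (k h : ℝ≥0∞)) ≤ᵐ[volume] ν ∧
      (N : ℝ≥0∞) ≤ ∫⁻ h, k h := by
  -- The mass away from the origin is finite by Lévy integrability, so all the infinite mass sits in
  -- the ball.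
  have hball : ∫⁻ h in Metric.ball 0 δ, ν h = ∞ := by
    by_contra hcon
    have h1 := lintegral_add_compl (μ := volume) ν (measurableSet_ball (x := (0 : Rd d)) (ε := δ))
    rw [hν.nonintegrable] at h1
    exact (ENNReal.add_lt_top.2 ⟨lt_top_iff_ne_top.2 hcon,
      hν.setLIntegral_compl_ball_lt_top hδ⟩).ne h1
  set w := hν.aemeasurable.mk ν with hw
  have hwm : Measurable w := hν.aemeasurable.measurable_mk
  have hwν : ν =ᵐ[volume] w := hν.aemeasurable.ae_eq_mk
  -- Truncating at height `n` keeps the kernel bounded, and by monotone convergence its mass still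
  -- exceeds `N` for some `n`.
  have hsup : ∫⁻ h in Metric.ball 0 δ, ν h = ⨆ n : ℕ, ∫⁻ h in Metric.ball 0 δ, min (w h) n := by
    rw [← lintegral_iSup (fun n => hwm.min measurable_const)
      (fun m n hmn h => min_le_min le_rfl (by exact_mod_cast hmn))]
    refine lintegral_congr_ae ?_
    filter_upwards [ae_restrict_of_ae hwν] with h hh
    rw [hh]
    show w h = ⨆ n : ℕ, w h ⊓ (n : ℝ≥0∞)
    rw [← inf_iSup_eq, ENNReal.iSup_natCast, inf_top_eq]
  rw [hball] at hsup
  obtain ⟨n, hn⟩ := lt_iSup_iff.1 (hsup ▸ ENNReal.coe_lt_top (r := N))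
  have hfin : ∀ h, min (w h) (n : ℝ≥0∞) ≠ ∞ := fun h =>
    ne_top_of_le_ne_top (ENNReal.natCast_ne_top n) (min_le_right _ _)
  refine ⟨(Metric.ball 0 δ).indicator fun h => (min (w h) n).toNNReal, n,
    (hwm.min measurable_const).ennreal_toNNReal.indicator measurableSet_ball, fun h => ?_,
    fun h hh => Set.indicator_of_notMem hh _, ?_, ?_⟩
  · refine (Set.indicator_le_self' (fun _ _ => zero_le) h).trans ?_
    rw [← ENNReal.coe_le_coe, ENNReal.coe_toNNReal (hfin h)]
    simp
  · filter_upwards [hwν] with h hh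
    by_cases hb : h ∈ Metric.ball (0 : Rd d) δ
    · rw [Set.indicator_of_mem hb, ENNReal.coe_toNNReal (hfin h), hh]
      exact min_le_left _ _
    · rw [Set.indicator_of_notMem hb]
      simp
  · refine hn.le.trans_eq ?_
    rw [← lintegral_indicator measurableSet_ball]
    refine lintegral_congr fun h => ?_
    by_cases hb : h ∈ Metric.ball (0 : Rd d) δ
    · rw [Set.indicator_of_mem hb, Set.indicator_of_mem hb, ENNReal.coe_toNNReal (hfin h)]
    · rw [Set.indicator_of_notMem hb, Set.indicator_of_notMem hb]
      simp

theorem ofReal_integral_le_lintegral_ofReal {α : Type*} [MeasurableSpace α] {μ : Measure α}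
    {f : α → ℝ} (hf : Integrable f μ) :
    ENNReal.ofReal (∫ x, f x ∂μ) ≤ ∫⁻ x, ENNReal.ofReal (f x) ∂μ := by
  calc ENNReal.ofReal (∫ x, f x ∂μ) ≤ ENNReal.ofReal (∫ x, max (f x) 0 ∂μ) :=
        ENNReal.ofReal_le_ofReal (integral_mono hf hf.pos_part fun x => le_max_left _ _)
    _ = ∫⁻ x, ENNReal.ofReal (max (f x) 0) ∂μ :=
        ofReal_integral_eq_lintegral_ofReal hf.pos_part (Eventually.of_forall fun x =>
          le_max_right _ _)
    _ = _ := by simp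

theorem memLp_kernel {k : Rd d → ℝ≥0} {c : ℝ≥0} {δ : ℝ} (hkm : Measurable k)
    (hkc : ∀ h, k h ≤ c) (hks : ∀ h, h ∉ Metric.ball 0 δ → k h = 0) (p : ℝ≥0∞) :
    MemLp (fun h => (k h : ℝ)) p volume := by
  have h1 : MemLp ((Metric.ball (0 : Rd d) δ).indicator fun _ => (c : ℝ)) p volume :=
    memLp_indicator_const _ measurableSet_ball _ (Or.inr measure_ball_lt_top.ne)
  refine h1.mono (by fun_prop) (Eventually.of_forall fun h => ?_)
  by_cases hb : h ∈ Metric.ball (0 : Rd d) δ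
  · rw [Set.indicator_of_mem hb]
    simpa using hkc h
  · rw [Set.indicator_of_notMem hb, hks h hb]
    simp

/-- The function `y ↦ k (x - y)` as an element of `L²(U)`. -/
noncomputable def kernelSlice (U : Set (Rd d)) {k : Rd d → ℝ}
    (hk : MemLp k 2 volume) (x : Rd d) : Lp ℝ 2 ((volume : Measure (Rd d)).restrict U) :=
  ((hk.comp_measurePreserving (Measure.measurePreserving_sub_left volume x)).restrict U).toLp

/-- Continuity of translations in `L²`. The bound is uniform in `x` and `y`, so a finite net of a
bounded set of points yields a finite net of slices; this is the source of compactness. -/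
theorem norm_kernelSlice_sub_le (U : Set (Rd d)) {k : Rd d → ℝ}
    (hk : MemLp k 2 volume) {ε : ℝ} (hε : 0 < ε) :
    ∃ ρ : ℝ, 0 < ρ ∧ ∀ x y : Rd d, dist x y < ρ →
      ‖kernelSlice U hk x - kernelSlice U hk y‖ ≤ ε := by
  obtain ⟨ρ, hρ, h⟩ := exists_eLpNorm_translate_le (by norm_num) (by norm_num) hk hε
  refine ⟨ρ, hρ, fun x y hxy => ?_⟩
  have h1 := h (x - y) (by rwa [← dist_eq_norm])
  rw [kernelSlice, kernelSlice, ← MemLp.toLp_sub, Lp.norm_toLp]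
  refine ENNReal.toReal_le_of_le_ofReal hε.le ?_
  refine (eLpNorm_mono_measure _ Measure.restrict_le_self).trans ?_
  have hz : AEStronglyMeasurable (fun w => k (x - y + w) - k w) volume :=
    (hk.1.comp_measurePreserving (measurePreserving_add_left volume (x - y))).sub hk.1
  rw [← eLpNorm_comp_measurePreserving hz (Measure.measurePreserving_sub_left volume y)] at h1
  refine le_of_eq_of_le (congrArg (fun f => eLpNorm f 2 volume) (funext fun w => ?_)) h1
  simp only [Pi.sub_apply, Function.comp]
  congr 2
  abel

/-- Expand the square and drop the nonnegative term `u(y)² k(x - y)`. By `hx` the slice vanishes off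
`U`, so it keeps its full mass on `U`. -/
theorem ofReal_le_lintegral_kernel {U : Set (Rd d)} {k : Rd d → ℝ≥0}
    (hk1 : Integrable (fun h => (k h : ℝ)) volume) (hk2 : MemLp (fun h => (k h : ℝ)) 2 volume)
    (u : Lp ℝ 2 ((volume : Measure (Rd d)).restrict U)) {x : Rd d}
    (hx : ∀ y, y ∉ U → k (x - y) = 0) :
    ENNReal.ofReal (u x ^ 2 * (∫ h, (k h : ℝ)) - 2 * u x * inner ℝ (kernelSlice U hk2 x) u) ≤
      ∫⁻ y in U, ENNReal.ofReal ((u x - u y) ^ 2) * (k (x - y) : ℝ≥0∞) := by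
  have hs : kernelSlice U hk2 x =ᵐ[volume.restrict U] fun y => (k (x - y) : ℝ) :=
    MemLp.coeFn_toLp _
  have hi1 : Integrable (fun y => (k (x - y) : ℝ)) (volume.restrict U) :=
    (hk1.comp_sub_left x).restrict
  have hi2 : Integrable (fun y => (k (x - y) : ℝ) * u y) (volume.restrict U) :=
    ((hk2.comp_measurePreserving (Measure.measurePreserving_sub_left volume x)).restrict
      U).integrable_mul (Lp.memLp u)
  have e1 : ∫ y in U, (k (x - y) : ℝ) = ∫ h, (k h : ℝ) := by
    rw [setIntegral_eq_integral_of_forall_compl_eq_zero (fun y hy => by simp [hx y hy]),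
      integral_sub_left_eq_self (fun h => (k h : ℝ))]
  have e2 : inner ℝ (kernelSlice U hk2 x) u = ∫ y in U, (k (x - y) : ℝ) * u y := by
    rw [L2.inner_def]
    refine integral_congr_ae ?_
    filter_upwards [hs] with y hy
    rw [hy]
    simp [mul_comm]
  rw [e2, ← e1, ← integral_const_mul, ← integral_const_mul,
    ← integral_sub (hi1.const_mul _) (hi2.const_mul _)]
  refine (ofReal_integral_le_lintegral_ofReal ((hi1.const_mul _).sub (hi2.const_mul _))).trans ?_
  refine lintegral_mono fun y => ?_
  rw [← ENNReal.ofReal_coe_nnreal, ← ENNReal.ofReal_mul (sq_nonneg _)]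
  refine ENNReal.ofReal_le_ofReal ?_
  simp only [Pi.sub_apply]
  nlinarith [mul_nonneg (sq_nonneg (u y)) (k (x - y)).2]

theorem IsSingularLevyDensity.energyControlled {ν : Rd d → ℝ≥0∞} (hν : IsSingularLevyDensity ν)
    {U A : Set (Rd d)} (hA : Bornology.IsBounded A) {δ : ℝ} (hδ : 0 < δ)
    (hAU : ∀ x ∈ A, Metric.ball x δ ⊆ U) (hAm : MeasurableSet A) : EnergyControlled ν U A := by
  intro ε' hε'
  obtain ⟨ε, hε0, hε⟩ := ENNReal.lt_iff_exists_nnreal_btwn.1 (pos_iff_ne_zero.2 hε')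
  have hε0 : (0 : ℝ) < ε := by exact_mod_cast hε0
  -- The energy will appear with coefficient `2 / m`, where `m` is the mass of `k`; mass at least `2
  -- / ε` makes it at most `ε`.
  obtain ⟨k, c, hkm, hkc, hks, hkν, hkN⟩ := hν.exists_kernel hδ (2 / ε)
  have hk1 : Integrable (fun h => (k h : ℝ)) volume :=
    memLp_one_iff_integrable.1 (memLp_kernel hkm hkc hks 1)
  have hk2 := memLp_kernel hkm hkc hks 2
  set m : ℝ := ∫ h, (k h : ℝ) with hm
  have hmN : 2 / ε ≤ m := by
    have h1 : ENNReal.ofReal m = ∫⁻ h, (k h : ℝ≥0∞) := by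
      rw [hm, ofReal_integral_eq_lintegral_ofReal hk1 (Eventually.of_forall fun h => (k h).2)]
      simp
    rw [← h1, ← ENNReal.ofReal_coe_nnreal] at hkN
    have := (ENNReal.ofReal_le_ofReal_iff (integral_nonneg fun h => (k h).2)).1 hkN
    simpa using this
  have hm0 : 0 < m := lt_of_lt_of_le (by positivity) hmN
  have hmε : 2 / m ≤ ε := by
    rw [div_le_iff₀ hε0] at hmN
    rw [div_le_iff₀ hm0]
    linarith
  set v : ℝ := (volume A).toReal with hv
  have hvA : volume A = ENNReal.ofReal v := (ENNReal.ofReal_toReal hA.measure_lt_top.ne).symm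
  have hv0 : 0 ≤ v := ENNReal.toReal_nonneg
  set b : ℝ := 8 / m ^ 2 * v with hb
  have hb0 : 0 ≤ b := by positivity
  -- `η` is the error of replacing a slice by one from the finite net; after integration over `A` it
  -- contributes `b η² ‖u‖²`.
  obtain ⟨η, hη0, hη⟩ : ∃ η : ℝ, 0 < η ∧ b * η ^ 2 ≤ ε := by
    refine ⟨Real.sqrt (ε / (b + 1)), by positivity, ?_⟩
    rw [Real.sq_sqrt (by positivity), mul_div_assoc', div_le_iff₀ (by positivity)]
    nlinarith
  obtain ⟨ρ, hρ, hnet⟩ := norm_kernelSlice_sub_le U hk2 hη0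
  obtain ⟨t, -, htf, hcov⟩ := Metric.finite_approx_of_totallyBounded
    (hA.isCompact_closure.totallyBounded.subset subset_closure) ρ hρ
  have := htf.to_subtype
  obtain ⟨n, ⟨e⟩⟩ := Finite.exists_equiv_fin t
  set L0 : Lp ℝ 2 ((volume : Measure (Rd d)).restrict U) →L[ℝ] (Fin n → ℝ) :=
    ContinuousLinearMap.pi fun i => innerSL ℝ (kernelSlice U hk2 (e.symm i)) with hL0
  refine ⟨n, Real.sqrt b • L0, fun u => ?_⟩
  have hu : Measurable u := (Lp.stronglyMeasurable u).measurable
  have hpt : ∀ x ∈ A, ENNReal.ofReal (u x ^ 2) ≤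
      ε * (∫⁻ y in U, ENNReal.ofReal ((u x - u y) ^ 2) * (k (x - y) : ℝ≥0∞)) +
        ENNReal.ofReal (8 / m ^ 2 * (η ^ 2 * ‖u‖ ^ 2 + ‖L0 u‖ ^ 2)) := by
    intro x hx
    obtain ⟨y, hy, hxy⟩ := Set.mem_iUnion₂.1 (hcov hx)
    have hin : |inner ℝ (kernelSlice U hk2 x) u| ≤ η * ‖u‖ + ‖L0 u‖ := by
      have h1 : inner ℝ (kernelSlice U hk2 x) u =
          inner ℝ (kernelSlice U hk2 x - kernelSlice U hk2 y) u +
            inner ℝ (kernelSlice U hk2 y) u := by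
        rw [← inner_add_left, sub_add_cancel]
      have h2 : |inner ℝ (kernelSlice U hk2 y) u| ≤ ‖L0 u‖ := by
        have := norm_le_pi_norm (L0 u) (e ⟨y, hy⟩)
        simpa [hL0] using this
      rw [h1]
      refine (abs_add_le _ _).trans (add_le_add ?_ h2)
      exact (abs_real_inner_le_norm _ _).trans (by gcongr; exact hnet x y hxy)
    have h3 := ofReal_le_lintegral_kernel (U := U) hk1 hk2 u (x := x) fun y hy => hks _ fun hb => by
      refine hy (hAU x hx ?_)
      rwa [Metric.mem_ball, dist_comm, dist_eq_norm, ← mem_ball_zero_iff]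
    set s : ℝ := inner ℝ (kernelSlice U hk2 x) u with hs
    have hs2 : s ^ 2 ≤ 2 * (η ^ 2 * ‖u‖ ^ 2 + ‖L0 u‖ ^ 2) := by
      rw [← sq_abs]
      have := pow_le_pow_left₀ (abs_nonneg s) hin 2
      nlinarith [sq_nonneg (η * ‖u‖ - ‖L0 u‖)]
    -- Completing the square: the right side with `4 / m ^ 2 * s ^ 2` as last term exceeds `u x ^ 2`
    -- by exactly `(u x - 2 * s / m) ^ 2`.
    have h4 : u x ^ 2 ≤ 2 / m * (u x ^ 2 * m - 2 * u x * s) +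
        8 / m ^ 2 * (η ^ 2 * ‖u‖ ^ 2 + ‖L0 u‖ ^ 2) := by
      have h5 : 4 / m ^ 2 * s ^ 2 ≤ 8 / m ^ 2 * (η ^ 2 * ‖u‖ ^ 2 + ‖L0 u‖ ^ 2) := by
        refine (mul_le_mul_of_nonneg_left hs2 (by positivity)).trans_eq ?_
        ring
      have h6 : 2 / m * (u x ^ 2 * m - 2 * u x * s) + 4 / m ^ 2 * s ^ 2 =
          u x ^ 2 + (u x - 2 * s / m) ^ 2 := by
        field_simp
        ring
      nlinarith [sq_nonneg (u x - 2 * s / m)]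
    refine (ENNReal.ofReal_le_ofReal h4).trans (ENNReal.ofReal_add_le.trans ?_)
    gcongr
    rw [ENNReal.ofReal_mul (by positivity)]
    gcongr
    rw [← ENNReal.ofReal_coe_nnreal]
    exact ENNReal.ofReal_le_ofReal hmε
  have hE := lintegral_kernel_le_energy (U := U) (A := A) (B := U) hν.aemeasurable
    hkm.coe_nnreal_ennreal hkν
    (fun x hx => hAU x hx (Metric.mem_ball_self hδ)) subset_rfl hu
  have hkm' := hkm.coe_nnreal_ennreal
  calc ∫⁻ x in A, ENNReal.ofReal (u x ^ 2)
      ≤ ∫⁻ x in A, (ε * (∫⁻ y in U, ENNReal.ofReal ((u x - u y) ^ 2) * (k (x - y) : ℝ≥0∞)) +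
        ENNReal.ofReal (8 / m ^ 2 * (η ^ 2 * ‖u‖ ^ 2 + ‖L0 u‖ ^ 2))) :=
        setLIntegral_mono' hAm hpt
    _ ≤ ε * energy ν U U u + ENNReal.ofReal (b * η ^ 2 * ‖u‖ ^ 2 + b * ‖L0 u‖ ^ 2) := by
        rw [lintegral_add_right _ measurable_const, lintegral_const_mul' _ _ ENNReal.coe_ne_top,
          setLIntegral_const, hvA, ← ENNReal.ofReal_mul (by positivity)]
        gcongr
        rw [hb]
        exact le_of_eq (by ring)
    _ ≤ ε' * energy ν U U u + (ε' * ‖u‖ₑ ^ 2 + ‖(Real.sqrt b • L0) u‖ₑ ^ 2) := by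
        gcongr
        rw [ENNReal.ofReal_add (by positivity) (by positivity)]
        gcongr
        · rw [ENNReal.ofReal_mul (by positivity), ENNReal.ofReal_pow (norm_nonneg _), ofReal_norm]
          gcongr
          refine (ENNReal.ofReal_le_ofReal hη).trans ?_
          rw [ENNReal.ofReal_coe_nnreal]
          exact hε.le
        · rw [_root_.smul_apply, ← ofReal_norm, ← ENNReal.ofReal_pow (norm_nonneg _),
            norm_smul, mul_pow, Real.norm_eq_abs, sq_abs, Real.sq_sqrt hb0]
    _ = _ := by ring

/-! ### Compactness from energy control, and passage to `V_ν(Ω|ℝ^d)`. -/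

/-- `T` need not be linear: `T a - T b` equals `a - b` on `Ω` and has norm at most `2 * C`, so the
estimate is applied to this difference and never to `T (a - b)`. -/
theorem EnergyControlled.isCompactOperator {ν : Rd d → ℝ≥0∞} {U Ω : Set (Rd d)}
    (hc : EnergyControlled ν U Ω) (hΩU : Ω ⊆ U) (T : H ν Ω → H ν U) {C : ℝ} (hC : 0 < C)
    (hT : ∀ u : H ν Ω,
      ‖T u‖ ≤ C * ‖u‖ ∧ H.incl ν U (T u) =ᵐ[volume.restrict Ω] H.incl ν Ω u) :
    IsCompactOperator (H.embedding ν Ω) := by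
  refine (isCompactOperator_iff_isCompact_closure_image_closedBall (r := 1)
    (H.embedding ν Ω : H ν Ω →ₗ[ℝ] Lp ℝ 2 ((volume : Measure (Rd d)).restrict Ω)) one_pos).2 ?_
  refine TotallyBounded.isCompact_of_isClosed (TotallyBounded.closure ?_) isClosed_closure
  rw [Set.image_eq_range]
  refine totallyBounded_range_of_dist_le _ fun ε hε => ?_
  obtain ⟨n, L, hL⟩ := hc.norm_le (η := ε / (2 * C)) (by positivity)
  have hTb : ∀ a : Metric.closedBall (0 : H ν Ω) 1, ‖T a‖ ≤ C := fun a => by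
    have ha : ‖(a : H ν Ω)‖ ≤ 1 := mem_closedBall_zero_iff.1 a.2
    refine ((hT a).1).trans ?_
    nlinarith
  refine ⟨n, fun a => L (H.incl ν U (T a)), ?_, fun a b => ?_⟩
  · refine isBounded_iff_forall_norm_le.2 ⟨‖L‖ * C, ?_⟩
    rintro _ ⟨a, rfl⟩
    exact (L.le_opNorm _).trans (by gcongr; exact (H.norm_incl_le _).trans (hTb a))
  · have h1 := hL (T a - T b)
    have h2 : dist (H.embedding ν Ω a) (H.embedding ν Ω b) =
        (eLpNorm (H.incl ν U (T a - T b)) 2 (volume.restrict Ω)).toReal := by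
      rw [dist_eq_norm, Lp.norm_def]
      congr 1
      refine eLpNorm_congr_ae ?_
      have h3 := ae_restrict_of_ae_restrict_of_subset hΩU
        (Lp.coeFn_sub (H.incl ν U (T a)) (H.incl ν U (T b)))
      filter_upwards [Lp.coeFn_sub (H.embedding ν Ω a) (H.embedding ν Ω b), h3, (hT a).2, (hT b).2]
        with x e1 e2 e3 e4
      rw [e1, map_sub, e2, Pi.sub_apply, Pi.sub_apply, e3, e4]
      rfl
    have h5 : ‖T a - T b‖ ≤ 2 * C := (norm_sub_le _ _).trans (by linarith [hTb a, hTb b])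
    refine h2.trans_le (h1.trans ?_)
    rw [dist_eq_norm, ← map_sub, ← map_sub]
    gcongr
    calc ε / (2 * C) * ‖T a - T b‖ ≤ ε / (2 * C) * (2 * C) := by gcongr
      _ = ε := by field_simp

theorem energy_mono_right (ν : Rd d → ℝ≥0∞) (A : Set (Rd d)) {B B' : Set (Rd d)} (h : B ⊆ B')
    (u : Rd d → ℝ) : energy ν A B u ≤ energy ν A B' u := by
  refine lintegral_mono' ?_ le_rfl
  refine Measure.le_iff.2 fun s hs => ?_
  rw [jumpMeasure, jumpMeasure, withDensity_apply _ hs, withDensity_apply _ hs]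
  refine lintegral_mono' (Measure.restrict_mono subset_rfl ?_) le_rfl
  rw [Measure.prod_restrict, Measure.prod_restrict]
  exact Measure.restrict_mono (Set.prod_mono subset_rfl h) le_rfl

theorem energy_toLp (ν : Rd d → ℝ≥0∞) (Ω : Set (Rd d)) {u : Rd d → ℝ}
    (hu : MemLp u 2 (volume.restrict Ω)) : energy ν Ω Ω (hu.toLp u) = energy ν Ω Ω u :=
  energy_congr hu.coeFn_toLp hu.coeFn_toLp

/-- The restriction map `V_ν(Ω|ℝ^d) → H_ν(Ω)`. -/
noncomputable def V.toH (ν : Rd d → ℝ≥0∞) (Ω : Set (Rd d)) : V ν Ω →L[ℝ] H ν Ω :=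
  LinearMap.mkContinuous
    { toFun := fun u => (⟨u.mem.2.1.toLp (V.toFun ν Ω u), by
        change energy ν Ω Ω _ < ∞
        rw [energy_toLp]
        exact (energy_mono_right ν Ω (Set.subset_univ _) _).trans_lt u.mem.2.2⟩ : HSub ν Ω)
      map_add' := fun u v => Subtype.ext (MemLp.toLp_add u.mem.2.1 v.mem.2.1)
      map_smul' := fun c u => Subtype.ext (MemLp.toLp_const_smul c u.mem.2.1) } 1
    (fun u => by
      rw [one_mul, V.norm_def]
      change nlNorm ν Ω Ω (u.mem.2.1.toLp (V.toFun ν Ω u)) ≤ _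
      rw [nlNorm_congr u.mem.2.1.coeFn_toLp u.mem.2.1.coeFn_toLp]
      refine Real.sqrt_le_sqrt (add_le_add le_rfl ?_)
      exact ENNReal.toReal_mono u.mem.2.2.ne (energy_mono_right ν Ω (Set.subset_univ _) _))

/-- The embedding of `V_ν(Ω|ℝ^d)` factors definitionally through the bounded restriction map
`V.toH`. -/
theorem V.isCompactOperator_embedding {ν : Rd d → ℝ≥0∞} {Ω : Set (Rd d)}
    (h : IsCompactOperator (H.embedding ν Ω)) : IsCompactOperator (V.embedding ν Ω) :=
  h.comp_clm (V.toH ν Ω)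

theorem ClassA1.isCompactOperator {ν : Rd d → ℝ≥0∞} {Ω : Set (Rd d)} (h : ClassA1 ν Ω)
    (hΩ : IsOpen Ω) (hΩb : Bornology.IsBounded Ω) : IsCompactOperator (H.embedding ν Ω) := by
  obtain ⟨T, C, hC, hT⟩ := h.extension
  -- In the whole space every ball is admissible, so the radius `1` is arbitrary.
  exact (h.toIsSingularLevyDensity.energyControlled hΩb one_pos (fun _ _ => Set.subset_univ _)
    hΩ.measurableSet).isCompactOperator (Set.subset_univ _) T hC hT

/-! ### Reduction to an estimate near the boundary. -/

theorem isOpen_innerSet {Ω : Set (Rd d)} (hΩ : IsOpen Ω) (σ : ℝ) : IsOpen (innerSet Ω σ) :=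
  hΩ.inter (isOpen_lt continuous_const (Metric.continuous_infDist_pt _))

theorem innerSet_anti (Ω : Set (Rd d)) {σ τ : ℝ} (h : σ ≤ τ) : innerSet Ω τ ⊆ innerSet Ω σ :=
  fun _ hx => ⟨hx.1, h.trans_lt hx.2⟩

/-- The distance from a point of `Ω` to the complement is attained on the frontier, so no point
outside `Ω` is closer than the frontier. -/
theorem ball_subset_of_mem_innerSet {Ω : Set (Rd d)} {σ : ℝ} {x : Rd d}
    (hx : x ∈ innerSet Ω σ) : Metric.ball x σ ⊆ Ω := by
  intro y hy
  by_contra hyΩ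
  obtain ⟨z, hzf, hz⟩ := exists_mem_frontier_infDist_compl_eq_dist hx.1
    (Set.ne_univ_iff_exists_notMem Ω |>.2 ⟨y, hyΩ⟩)
  have h1 := Metric.infDist_le_dist_of_mem (x := x) hzf
  have h2 := Metric.infDist_le_dist_of_mem (x := x) (s := Ωᶜ) hyΩ
  rw [Metric.mem_ball, dist_comm] at hy
  linarith [hx.2]

/-- The `L²`-norm on `Ω ∩ W` is controlled by an arbitrarily small multiple of the energy and a
multiple of the `L²`-norm away from the boundary. -/
def BoundaryControlled (ν : Rd d → ℝ≥0∞) (Ω W : Set (Rd d)) : Prop :=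
  ∀ ε : ℝ≥0∞, ε ≠ 0 → ∃ σ : ℝ, 0 < σ ∧ ∃ C : ℝ≥0, ∀ u : Rd d → ℝ, Measurable u →
    ∫⁻ x in Ω ∩ W, ENNReal.ofReal (u x ^ 2) ≤
      ε * energy ν Ω Ω u + C * ∫⁻ x in innerSet Ω σ, ENNReal.ofReal (u x ^ 2)

theorem BoundaryControlled.isCompactOperator {ν : Rd d → ℝ≥0∞} {Ω : Set (Rd d)}
    (h : BoundaryControlled ν Ω Set.univ) (hν : IsSingularLevyDensity ν)
    (hΩ : IsOpen Ω) (hΩb : Bornology.IsBounded Ω) : IsCompactOperator (H.embedding ν Ω) := by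
  suffices EnergyControlled ν Ω Ω from
    this.isCompactOperator subset_rfl id one_pos fun u => ⟨by simp, ae_eq_refl _⟩
  intro ε hε
  obtain ⟨σ, hσ, C, hC⟩ := h (ε / 2) (by simp [hε])
  -- The interior estimate gets multiplied by `C`, hence the tolerance `ε / 2 / (C + 1)`; the `+ 1`
  -- covers `C = 0`.
  obtain ⟨n, L, hL⟩ := hν.energyControlled (hΩb.subset fun _ hx => hx.1) hσ
    (fun x hx => ball_subset_of_mem_innerSet hx) (isOpen_innerSet hΩ σ).measurableSet
    (ε / 2 / (C + 1)) (ENNReal.div_ne_zero.2 ⟨by simp [hε], by finiteness⟩)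
  refine ⟨n, Real.sqrt C • L, fun u => ?_⟩
  have h1 := hC u (Lp.stronglyMeasurable u).measurable
  rw [Set.inter_univ] at h1
  refine h1.trans ?_
  have h2 : (C : ℝ≥0∞) * (ε / 2 / (C + 1)) ≤ ε / 2 := by
    rw [← mul_div_assoc]
    refine ENNReal.div_le_of_le_mul ?_
    rw [mul_comm]
    gcongr
    exact le_self_add
  have h3 : ‖(Real.sqrt C • L) u‖ₑ ^ 2 = C * ‖L u‖ₑ ^ 2 := by
    rw [_root_.smul_apply, enorm_smul, mul_pow, ← ofReal_norm (Real.sqrt C),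
      ← ENNReal.ofReal_pow (norm_nonneg _), Real.norm_eq_abs, sq_abs, Real.sq_sqrt (NNReal.coe_nonneg C),
      ENNReal.ofReal_coe_nnreal]
  calc ε / 2 * energy ν Ω Ω u + C * ∫⁻ x in innerSet Ω σ, ENNReal.ofReal (u x ^ 2)
      ≤ ε / 2 * energy ν Ω Ω u +
          C * (ε / 2 / (C + 1) * (energy ν Ω Ω u + ‖u‖ₑ ^ 2) + ‖L u‖ₑ ^ 2) := by
        gcongr
        exact hL u
    _ = ε / 2 * energy ν Ω Ω u + C * (ε / 2 / (C + 1)) * (energy ν Ω Ω u + ‖u‖ₑ ^ 2) +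
          ‖(Real.sqrt C • L) u‖ₑ ^ 2 := by rw [h3]; ring
    _ ≤ ε / 2 * (energy ν Ω Ω u + ‖u‖ₑ ^ 2) + ε / 2 * (energy ν Ω Ω u + ‖u‖ₑ ^ 2) +
          ‖(Real.sqrt C • L) u‖ₑ ^ 2 := by
        gcongr
        exact le_self_add
    _ = _ := by rw [← add_mul, ENNReal.add_halves]

theorem frontier_nonempty_of_isBounded (hd : 1 ≤ d) {Ω : Set (Rd d)}
    (hΩb : Bornology.IsBounded Ω) (hne : Ω.Nonempty) : (frontier Ω).Nonempty := by
  have : Nonempty (Fin d) := ⟨⟨0, hd⟩⟩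
  refine nonempty_frontier_iff.2 ⟨hne, ?_⟩
  rintro rfl
  exact NormedSpace.unbounded_univ ℝ (Rd d) hΩb

/-! ### The boundary estimate under `ClassA3`. -/

/-- The part of a Lévy density away from the origin is an integrable kernel. -/
theorem IsSingularLevyDensity.exists_kernel_compl_ball {ν : Rd d → ℝ≥0∞}
    (hν : IsSingularLevyDensity ν) {δ : ℝ} (hδ : 0 < δ) :
    ∃ k : Rd d → ℝ≥0, Measurable k ∧ (∀ h ∈ Metric.ball 0 δ, k h = 0) ∧
      (∀ᵐ h, h ∉ Metric.ball 0 δ → (k h : ℝ≥0∞) = ν h) ∧ ∫⁻ h, (k h : ℝ≥0∞) < ∞ := by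
  have hlt := hν.setLIntegral_compl_ball_lt_top hδ
  have hae : ∀ᵐ h, h ∉ Metric.ball (0 : Rd d) δ → ν h < ∞ :=
    (ae_restrict_iff' measurableSet_ball.compl).1
      (ae_lt_top' hν.aemeasurable.restrict hlt.ne)
  have hk : ∀ᵐ h, h ∉ Metric.ball (0 : Rd d) δ →
      (((Metric.ball 0 δ)ᶜ.indicator
        (fun h => (hν.aemeasurable.mk ν h).toNNReal) h : ℝ≥0) : ℝ≥0∞) = ν h := by
    filter_upwards [hae, hν.aemeasurable.ae_eq_mk] with h h1 h2 hb
    rw [Set.indicator_of_mem hb, ← h2, ENNReal.coe_toNNReal (h1 hb).ne]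
  refine ⟨(Metric.ball 0 δ)ᶜ.indicator fun h => (hν.aemeasurable.mk ν h).toNNReal,
    hν.aemeasurable.measurable_mk.ennreal_toNNReal.indicator measurableSet_ball.compl,
    fun h hh => Set.indicator_of_notMem (by simpa using hh) _, hk, ?_⟩
  refine lt_of_le_of_lt ?_ hlt
  rw [← lintegral_indicator measurableSet_ball.compl]
  refine lintegral_mono_ae ?_
  filter_upwards [hk] with h h1
  by_cases hb : h ∈ Metric.ball (0 : Rd d) δ
  · simp [hb]
  · rw [h1 hb, Set.indicator_of_mem hb]

theorem lintegral_lintegral_kernel_le {A B : Set (Rd d)} {k f : Rd d → ℝ≥0∞}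
    (hk : Measurable k) (hf : Measurable f) :
    ∫⁻ x in A, ∫⁻ y in B, f y * k (y - x) ≤ (∫⁻ h, k h) * ∫⁻ y in B, f y := by
  rw [lintegral_lintegral_swap (by fun_prop), ← lintegral_const_mul _ hf]
  refine lintegral_mono fun y => ?_
  rw [lintegral_const_mul _ (by fun_prop), mul_comm]
  refine mul_le_mul' ?_ le_rfl
  refine (setLIntegral_le_lintegral _ _).trans_eq ?_
  exact lintegral_sub_left_eq_self k y

theorem ofReal_sq_le (a b : ℝ) :
    ENNReal.ofReal (a ^ 2) ≤ 2 * ENNReal.ofReal ((a - b) ^ 2) + 2 * ENNReal.ofReal (b ^ 2) := by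
  have h2 : (2 : ℝ≥0∞) = ENNReal.ofReal 2 := by simp
  rw [h2, ← ENNReal.ofReal_mul (by norm_num), ← ENNReal.ofReal_mul (by norm_num),
    ← ENNReal.ofReal_add (by positivity) (by positivity)]
  refine ENNReal.ofReal_le_ofReal ?_
  nlinarith [sq_nonneg (a - 2 * b)]

/-- Continuity of translations in `L¹`, with error `1`. It carries the lower bound in `qTilde`,
known only at boundary points `a`, over to nearby points `x`, with one `ρ` for all `a` and all `B`.
-/
theorem setLIntegral_translate_le {k : Rd d → ℝ≥0} (hkm : Measurable k)
    (hk : ∫⁻ h, (k h : ℝ≥0∞) < ∞) :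
    ∃ ρ : ℝ, 0 < ρ ∧ ∀ x a : Rd d, dist x a < ρ → ∀ B : Set (Rd d),
      ∫⁻ y in B, (k (y - a) : ℝ≥0∞) ≤ (∫⁻ y in B, (k (y - x) : ℝ≥0∞)) + 1 := by
  have hi : MemLp (fun h => (k h : ℝ)) 1 volume := by
    rw [memLp_one_iff_integrable]
    refine ⟨by fun_prop, ?_⟩
    simpa [HasFiniteIntegral, enorm_eq_nnnorm] using hk
  obtain ⟨ρ, hρ, h⟩ := exists_eLpNorm_translate_le le_rfl ENNReal.one_ne_top hi one_pos
  refine ⟨ρ, hρ, fun x a hxa B => ?_⟩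
  have h1 := h (x - a) (by rwa [← dist_eq_norm])
  rw [eLpNorm_one_eq_lintegral_enorm, ENNReal.ofReal_one,
    ← lintegral_sub_right_eq_self (fun y => ‖(k (x - a + y) : ℝ) - k y‖ₑ) x] at h1
  have h2 : ∀ y, (k (y - a) : ℝ≥0∞) ≤
      k (y - x) + ‖(k (x - a + (y - x)) : ℝ) - k (y - x)‖ₑ := fun y => by
    have e : x - a + (y - x) = y - a := by abel
    rw [e, ← ofReal_norm, ← ENNReal.ofReal_coe_nnreal, ← ENNReal.ofReal_coe_nnreal,
      ← ENNReal.ofReal_add (by positivity) (by positivity)]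
    refine ENNReal.ofReal_le_ofReal ?_
    linarith [Real.le_norm_self ((k (y - a) : ℝ) - k (y - x))]
  calc ∫⁻ y in B, (k (y - a) : ℝ≥0∞)
      ≤ ∫⁻ y in B, ((k (y - x) : ℝ≥0∞) + ‖(k (x - a + (y - x)) : ℝ) - k (y - x)‖ₑ) :=
        lintegral_mono h2
    _ = (∫⁻ y in B, (k (y - x) : ℝ≥0∞)) +
          ∫⁻ y in B, ‖(k (x - a + (y - x)) : ℝ) - k (y - x)‖ₑ :=
        lintegral_add_left (by fun_prop) _
    _ ≤ _ := by
        gcongr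
        exact (setLIntegral_le_lintegral _ _).trans h1

theorem ClassA3.boundaryControlled {ν : Rd d → ℝ≥0∞} {Ω : Set (Rd d)} (h : ClassA3 ν Ω)
    (hd : 1 ≤ d) (hΩ : IsOpen Ω) (hΩb : Bornology.IsBounded Ω) :
    BoundaryControlled ν Ω Set.univ := by
  have hν := h.toIsSingularLevyDensity
  have : Nonempty (Fin d) := ⟨⟨0, hd⟩⟩
  intro ε' hε'
  obtain ⟨ε, hε0, hε⟩ := ENNReal.lt_iff_exists_nnreal_btwn.1 (pos_iff_ne_zero.2 hε')
  have hε0 : 0 < ε := by exact_mod_cast hε0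
  -- The `+ 1` pays for moving from `a` to `x`; the factor `2` in `2 / ε` cancels the one from
  -- `ofReal_sq_le`.
  have hev := h.tendsto_qTilde.eventually (lt_mem_nhds (ENNReal.coe_lt_top (r := 2 / ε + 1)))
  obtain ⟨δ, hqδ, hδ⟩ := (hev.and self_mem_nhdsWithin).exists
  have hδ : 0 < δ := hδ
  obtain ⟨k, hkm, hk0, hkν, hkfin⟩ := hν.exists_kernel_compl_ball hδ
  obtain ⟨ρ, hρ, hkρ⟩ := setLIntegral_translate_le hkm hkfin
  have hkm' := hkm.coe_nnreal_ennreal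
  set B := innerSet Ω δ with hB
  set S := Ω \ innerSet Ω (ρ / 2) with hS
  have hBm : MeasurableSet B := (isOpen_innerSet hΩ δ).measurableSet
  have hlow : ∀ x ∈ S, ((2 / ε : ℝ≥0) : ℝ≥0∞) ≤ ∫⁻ y in B, (k (y - x) : ℝ≥0∞) := by
    rintro x ⟨hxΩ, hxi⟩
    have hx1 : Metric.infDist x (frontier Ω) < ρ := by
      by_contra hcon
      exact hxi ⟨hxΩ, by linarith⟩
    obtain ⟨a, ha, hxa⟩ := (Metric.infDist_lt_iff
      (frontier_nonempty_of_isBounded hd hΩb ⟨x, hxΩ⟩)).1 hx1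
    have h1 : ((2 / ε + 1 : ℝ≥0) : ℝ≥0∞) ≤ ∫⁻ y in B, ν (y - a) :=
      hqδ.le.trans (iInf₂_le a ha)
    -- Points of `B` are farther than `δ` from `a`, so the singularity of `ν` is never seen and the
    -- integrable part `k` suffices.
    have h2 : ∫⁻ y in B, ν (y - a) = ∫⁻ y in B, (k (y - a) : ℝ≥0∞) := by
      refine setLIntegral_congr_fun_ae hBm ?_
      filter_upwards [(measurePreserving_sub_right volume a).quasiMeasurePreserving.ae hkν]
        with y hy hyB
      refine (hy ?_).symm
      have h3 := Metric.infDist_le_dist_of_mem (x := y) ha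
      rw [dist_eq_norm] at h3
      rw [mem_ball_zero_iff, not_lt]
      exact hyB.2.le.trans h3
    rw [h2] at h1
    have h4 := h1.trans (hkρ x a hxa B)
    rw [ENNReal.coe_add, ENNReal.coe_one] at h4
    exact (ENNReal.add_le_add_iff_right ENNReal.one_ne_top).1 h4
  -- The energy weighs a pair with `ν (x - y)` whereas `k` is evaluated at `y - x`; the symmetry of
  -- `ν` reconciles the two.
  have hkneg : (fun z => (k (-z) : ℝ≥0∞)) ≤ᵐ[volume] ν := by
    filter_upwards [(Measure.measurePreserving_neg
      (volume : Measure (Rd d))).quasiMeasurePreserving.ae hkν] with z hz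
    by_cases hb : -z ∈ Metric.ball (0 : Rd d) δ
    · simp [hk0 _ hb]
    · rw [hz hb, hν.symm]
      rintro rfl
      exact hb (by simpa using hδ)
  obtain ⟨κ, hκ⟩ : ∃ κ : ℝ≥0, ∫⁻ h, (k h : ℝ≥0∞) = κ := ⟨_, (ENNReal.coe_toNNReal hkfin.ne).symm⟩
  refine ⟨min δ (ρ / 2), by positivity, ε * κ + 1, fun u hu => ?_⟩
  have hE := lintegral_kernel_le_energy (U := Ω) (A := S) (B := B) hν.aemeasurable
    (k := fun z => (k (-z) : ℝ≥0∞)) (by fun_prop) hkneg (fun x hx => hx.1) (fun x hx => hx.1) hu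
  simp only [neg_sub] at hE
  have hSm : MeasurableSet S := hΩ.measurableSet.diff (isOpen_innerSet hΩ _).measurableSet
  -- Compare `u x` with `u y` for `y ∈ B`, weighted by `k (y - x)`: the differences go into the
  -- energy, and the terms `u y ^ 2` cost the total mass `κ` of `k`.
  have hmain : ((2 / ε : ℝ≥0) : ℝ≥0∞) * ∫⁻ x in S, ENNReal.ofReal (u x ^ 2) ≤
      2 * energy ν Ω Ω u + 2 * (κ * ∫⁻ y in B, ENNReal.ofReal (u y ^ 2)) := by
    rw [← lintegral_const_mul _ (by fun_prop)]
    calc ∫⁻ x in S, ((2 / ε : ℝ≥0) : ℝ≥0∞) * ENNReal.ofReal (u x ^ 2)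
        ≤ ∫⁻ x in S, ((2 * ∫⁻ y in B, ENNReal.ofReal ((u x - u y) ^ 2) * (k (y - x) : ℝ≥0∞)) +
            2 * ∫⁻ y in B, ENNReal.ofReal (u y ^ 2) * (k (y - x) : ℝ≥0∞)) := by
          refine setLIntegral_mono' hSm fun x hx => ?_
          refine (mul_le_mul_left (hlow x hx) _).trans ?_
          rw [← lintegral_mul_const _ (by fun_prop), ← lintegral_const_mul _ (by fun_prop),
            ← lintegral_const_mul _ (by fun_prop), ← lintegral_add_left (by fun_prop)]
          refine lintegral_mono fun y => ?_
          refine (mul_le_mul_right (ofReal_sq_le (u x) (u y)) _).trans_eq ?_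
          ring
      _ = 2 * (∫⁻ x in S, ∫⁻ y in B, ENNReal.ofReal ((u x - u y) ^ 2) * (k (y - x) : ℝ≥0∞)) +
            2 * ∫⁻ x in S, ∫⁻ y in B, ENNReal.ofReal (u y ^ 2) * (k (y - x) : ℝ≥0∞) := by
          have hm1 : Measurable fun x => ∫⁻ y in B,
              ENNReal.ofReal ((u x - u y) ^ 2) * (k (y - x) : ℝ≥0∞) :=
            Measurable.lintegral_prod_right (by fun_prop)
          rw [lintegral_add_left (hm1.const_mul _), lintegral_const_mul _ hm1,
            lintegral_const_mul _ (Measurable.lintegral_prod_right (by fun_prop))]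
      _ ≤ _ := by
          gcongr
          rw [← hκ]
          exact lintegral_lintegral_kernel_le hkm' (by fun_prop)
  have hε2 : ((ε / 2 : ℝ≥0) : ℝ≥0∞) * ((2 / ε : ℝ≥0) : ℝ≥0∞) = 1 := by
    rw [← ENNReal.coe_mul]
    norm_cast
    field_simp
  have hε3 : ((ε / 2 : ℝ≥0) : ℝ≥0∞) * 2 = ε := by
    rw [← ENNReal.coe_ofNat, ← ENNReal.coe_mul]
    norm_cast
    field_simp
  have hSle : ∫⁻ x in S, ENNReal.ofReal (u x ^ 2) ≤
      ε * energy ν Ω Ω u + ε * κ * ∫⁻ y in B, ENNReal.ofReal (u y ^ 2) := by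
    calc ∫⁻ x in S, ENNReal.ofReal (u x ^ 2)
        = ((ε / 2 : ℝ≥0) : ℝ≥0∞) * (((2 / ε : ℝ≥0) : ℝ≥0∞) *
            ∫⁻ x in S, ENNReal.ofReal (u x ^ 2)) := by rw [← mul_assoc, hε2, one_mul]
      _ ≤ ((ε / 2 : ℝ≥0) : ℝ≥0∞) *
            (2 * energy ν Ω Ω u + 2 * (κ * ∫⁻ y in B, ENNReal.ofReal (u y ^ 2))) := by gcongr
      _ = ((ε / 2 : ℝ≥0) : ℝ≥0∞) * 2 * energy ν Ω Ω u + ((ε / 2 : ℝ≥0) : ℝ≥0∞) * 2 *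
            κ * ∫⁻ y in B, ENNReal.ofReal (u y ^ 2) := by ring
      _ = _ := by rw [hε3]
  have hcover : Ω ∩ Set.univ ⊆ S ∪ innerSet Ω (ρ / 2) := fun x hx => by
    by_cases hxi : x ∈ innerSet Ω (ρ / 2)
    · exact Or.inr hxi
    · exact Or.inl ⟨hx.1, hxi⟩
  calc ∫⁻ x in Ω ∩ Set.univ, ENNReal.ofReal (u x ^ 2)
      ≤ (∫⁻ x in S, ENNReal.ofReal (u x ^ 2)) +
          ∫⁻ x in innerSet Ω (ρ / 2), ENNReal.ofReal (u x ^ 2) :=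
        (lintegral_mono_set hcover).trans (lintegral_union_le _ _ _)
    _ ≤ (ε' * energy ν Ω Ω u + ε * κ *
            ∫⁻ y in innerSet Ω (min δ (ρ / 2)), ENNReal.ofReal (u y ^ 2)) +
          ∫⁻ x in innerSet Ω (min δ (ρ / 2)), ENNReal.ofReal (u x ^ 2) := by
        refine add_le_add (hSle.trans ?_)
          (lintegral_mono_set (innerSet_anti Ω (min_le_right _ _)))
        gcongr
        exact innerSet_anti Ω (min_le_left _ _)
    _ = _ := by
        push_cast
        ring

/-! ### Energy of a single jump and chains of jumps. -/

/-- `∫ (u(y + h) - u(y))² dy` over all `y` with `y, y + h ∈ Ω`. -/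
noncomputable def shiftEnergy (Ω : Set (Rd d)) (u : Rd d → ℝ) (h : Rd d) : ℝ≥0∞ :=
  ∫⁻ y in Ω ∩ (fun y => y + h) ⁻¹' Ω, ENNReal.ofReal ((u (y + h) - u y) ^ 2)

/-- Tonelli and the substitution `x = y + h` slice the double integral by the jump `h`. -/
theorem lintegral_mul_shiftEnergy_le_energy {ν k : Rd d → ℝ≥0∞} (hν : AEMeasurable ν volume)
    (hk : Measurable k) (hle : k ≤ᵐ[volume] ν) {Ω : Set (Rd d)} (hΩ : MeasurableSet Ω)
    {u : Rd d → ℝ} (hu : Measurable u) :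
    ∫⁻ h, k h * shiftEnergy Ω u h ≤ energy ν Ω Ω u := by
  refine le_of_eq_of_le ?_ (lintegral_kernel_le_energy hν hk hle subset_rfl subset_rfl hu)
  set F : Rd d → Rd d → ℝ≥0∞ := fun x y =>
    (Ω ×ˢ Ω).indicator (fun p : Rd d × Rd d => ENNReal.ofReal ((u p.1 - u p.2) ^ 2)) (x, y) with hF
  have hFm : Measurable (Function.uncurry F) :=
    Measurable.indicator (by fun_prop) (hΩ.prod hΩ)
  have e1 : ∀ h, shiftEnergy Ω u h = ∫⁻ y, F (y + h) y := fun h => by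
    rw [shiftEnergy, ← lintegral_indicator
      (hΩ.inter (measurable_add_const h hΩ))]
    refine lintegral_congr fun y => ?_
    by_cases h1 : y ∈ Ω <;> by_cases h2 : y + h ∈ Ω <;> simp [hF, h1, h2]
  have e2 : ∀ x, ∫⁻ y in Ω, ENNReal.ofReal ((u x - u y) ^ 2) * k (x - y) =
      ∫⁻ y, Ω.indicator (fun y => ENNReal.ofReal ((u x - u y) ^ 2) * k (x - y)) y := fun x =>
    (lintegral_indicator hΩ _).symm
  have e3 : ∫⁻ x in Ω, ∫⁻ y in Ω, ENNReal.ofReal ((u x - u y) ^ 2) * k (x - y) =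
      ∫⁻ x, ∫⁻ y, F x y * k (x - y) := by
    rw [← lintegral_indicator hΩ]
    refine lintegral_congr fun x => ?_
    by_cases hx : x ∈ Ω
    · rw [Set.indicator_of_mem hx, e2]
      refine lintegral_congr fun y => ?_
      by_cases hy : y ∈ Ω
      · simp [hF, hx, hy]
      · simp [hF, hy]
    · rw [Set.indicator_of_notMem hx]
      simp [hF, hx]
  have hF2 : Measurable fun p : Rd d × Rd d => F p.1 p.2 := hFm
  have hF3 : Measurable fun p : Rd d × Rd d => F (p.2 + p.1) p.2 :=
    hF2.comp ((measurable_snd.add measurable_fst).prodMk measurable_snd)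
  have hF4 : ∀ h : Rd d, Measurable fun y => F (y + h) y := fun h =>
    hF3.comp (measurable_const.prodMk measurable_id)
  have hF5 : Measurable fun p : Rd d × Rd d => k p.1 * F (p.2 + p.1) p.2 :=
    (hk.comp measurable_fst).mul hF3
  have hF6 : Measurable fun p : Rd d × Rd d => F p.1 p.2 * k (p.1 - p.2) :=
    hF2.mul (hk.comp (measurable_fst.sub measurable_snd))
  calc ∫⁻ h, k h * shiftEnergy Ω u h = ∫⁻ h, ∫⁻ y, k h * F (y + h) y := by
        refine lintegral_congr fun h => ?_
        rw [e1, lintegral_const_mul _ (hF4 h)]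
    _ = ∫⁻ y, ∫⁻ h, k h * F (y + h) y := lintegral_lintegral_swap hF5.aemeasurable
    _ = ∫⁻ y, ∫⁻ x, F x y * k (x - y) := by
        refine lintegral_congr fun y => ?_
        rw [← lintegral_add_left_eq_self (fun x => F x y * k (x - y)) y]
        refine lintegral_congr fun h => ?_
        rw [add_sub_cancel_left, mul_comm]
    _ = ∫⁻ x, ∫⁻ y, F x y * k (x - y) :=
        (lintegral_lintegral_swap hF6.aemeasurable).symm
    _ = _ := e3.symm

theorem sq_sub_le_mul_sum_range (f : ℕ → ℝ) (k : ℕ) :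
    (f 0 - f k) ^ 2 ≤ k * ∑ j ∈ Finset.range k, (f (j + 1) - f j) ^ 2 := by
  have h := sq_sum_le_card_mul_sum_sq (s := Finset.range k) (f := fun j => f (j + 1) - f j)
  rw [Finset.sum_range_sub, Finset.card_range] at h
  linarith [sq_nonneg (f 0 - f k), show (f 0 - f k) ^ 2 = (f k - f 0) ^ 2 by ring]

/-- `k` jumps of size `h` cost at most `k²` times one jump. -/
theorem setLIntegral_sq_sub_le_shiftEnergy {Ω A : Set (Rd d)} (hΩ : MeasurableSet Ω)
    (hA : MeasurableSet A) {u : Rd d → ℝ} (hu : Measurable u) {h : Rd d} {k : ℕ}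
    (hk : ∀ x ∈ A, ∀ j : ℕ, j ≤ k → x + (j : ℝ) • h ∈ Ω) :
    ∫⁻ x in A, ENNReal.ofReal ((u x - u (x + (k : ℝ) • h)) ^ 2) ≤
      (k : ℝ≥0∞) ^ 2 * shiftEnergy Ω u h := by
  set E : Set (Rd d) := Ω ∩ (fun y => y + h) ⁻¹' Ω with hE
  have hEm : MeasurableSet E := hΩ.inter (measurable_add_const h hΩ)
  set F : Rd d → ℝ≥0∞ := fun y => ENNReal.ofReal ((u (y + h) - u y) ^ 2) with hF
  have hFm : Measurable F := by fun_prop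
  have hstep : ∀ j ∈ Finset.range k,
      -- Translation by `j • h` moves `A` into the domain of `shiftEnergy`, because steps `j` and `j
      -- + 1` both stay in `Ω`.
      ∫⁻ x in A, F (x + (j : ℝ) • h) ≤ shiftEnergy Ω u h := by
    intro j hj
    have hjk := Finset.mem_range.1 hj
    rw [shiftEnergy, ← lintegral_indicator hEm, ← lintegral_indicator hA,
      ← lintegral_add_right_eq_self (E.indicator F) ((j : ℝ) • h)]
    refine lintegral_mono fun x => ?_
    by_cases hx : x ∈ A
    · have hmem : x + (j : ℝ) • h ∈ E := by
        refine ⟨hk x hx j hjk.le, ?_⟩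
        have := hk x hx (j + 1) hjk
        rw [Set.mem_preimage]
        convert this using 1
        push_cast
        rw [add_smul, one_smul, add_assoc]
      simp only [Set.indicator_of_mem hx, Set.indicator_of_mem hmem]
      exact le_rfl
    · simp only [Set.indicator_of_notMem hx]
      exact zero_le
  calc ∫⁻ x in A, ENNReal.ofReal ((u x - u (x + (k : ℝ) • h)) ^ 2)
      ≤ ∫⁻ x in A, (k : ℝ≥0∞) * ∑ j ∈ Finset.range k, F (x + (j : ℝ) • h) := by
        refine lintegral_mono fun x => ?_
        have h1 := sq_sub_le_mul_sum_range (fun j : ℕ => u (x + (j : ℝ) • h)) k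
        simp only [Nat.cast_zero, zero_smul, add_zero] at h1
        refine (ENNReal.ofReal_le_ofReal h1).trans_eq ?_
        rw [ENNReal.ofReal_mul (Nat.cast_nonneg k), ENNReal.ofReal_natCast,
          ENNReal.ofReal_sum_of_nonneg fun _ _ => sq_nonneg _]
        congr 1
        refine Finset.sum_congr rfl fun j _ => ?_
        simp only [hF, Nat.cast_add, Nat.cast_one, add_smul, one_smul, add_assoc]
    _ = (k : ℝ≥0∞) * ∑ j ∈ Finset.range k, ∫⁻ x in A, F (x + (j : ℝ) • h) := by
        rw [lintegral_const_mul _ (by fun_prop), lintegral_finsetSum _ (by fun_prop)]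
    _ ≤ (k : ℝ≥0∞) * ∑ j ∈ Finset.range k, shiftEnergy Ω u h := by
        gcongr with j hj
        exact hstep j hj
    _ = _ := by
        rw [Finset.sum_const, Finset.card_range, nsmul_eq_mul]
        ring

/-- A chain of `k = ⌈δ / ‖h‖⌉₊` jumps has length at most `2 * δ`, so `‖h‖² k² ≤ 4 δ²`: multiplying
by `‖h‖²` makes the cost of the chain uniform in `h`. This is why `q` carries the weight `‖h‖²`. -/
theorem ofReal_norm_sq_mul_setLIntegral_le {Ω A B : Set (Rd d)} (hΩ : MeasurableSet Ω)
    (hA : MeasurableSet A) (hB : MeasurableSet B) {u : Rd d → ℝ} (hu : Measurable u) {h : Rd d}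
    {δ : ℝ} (hh : ‖h‖ ≤ δ) (hh0 : h ≠ 0)
    (hk : ∀ x ∈ A, ∀ j : ℕ, j ≤ ⌈δ / ‖h‖⌉₊ → x + (j : ℝ) • h ∈ Ω)
    (hkB : ∀ x ∈ A, x + (⌈δ / ‖h‖⌉₊ : ℝ) • h ∈ B) :
    ENNReal.ofReal (‖h‖ ^ 2) * ∫⁻ x in A, ENNReal.ofReal (u x ^ 2) ≤
      ENNReal.ofReal (8 * δ ^ 2) * shiftEnergy Ω u h +
        2 * ENNReal.ofReal (‖h‖ ^ 2) * ∫⁻ x in B, ENNReal.ofReal (u x ^ 2) := by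
  have hn : 0 < ‖h‖ := norm_pos_iff.2 hh0
  set k := ⌈δ / ‖h‖⌉₊ with hkdef
  have hkδ : ‖h‖ * k ≤ 2 * δ := by
    have h1 : (k : ℝ) < δ / ‖h‖ + 1 :=
      Nat.ceil_lt_add_one (div_nonneg (hn.le.trans hh) hn.le)
    have h2 : ‖h‖ * (δ / ‖h‖ + 1) = δ + ‖h‖ := by field_simp
    nlinarith
  have hshift : ∫⁻ x in A, ENNReal.ofReal (u (x + (k : ℝ) • h) ^ 2) ≤
      ∫⁻ x in B, ENNReal.ofReal (u x ^ 2) := by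
    rw [← lintegral_indicator hA, ← lintegral_indicator hB, ← lintegral_add_right_eq_self
      (B.indicator fun x => ENNReal.ofReal (u x ^ 2)) ((k : ℝ) • h)]
    refine lintegral_mono fun x => ?_
    by_cases hx : x ∈ A
    · simp only [Set.indicator_of_mem hx, Set.indicator_of_mem (hkB x hx)]
      exact le_rfl
    · simp only [Set.indicator_of_notMem hx]
      exact zero_le
  have hk2 : ENNReal.ofReal (‖h‖ ^ 2) * (2 * (k : ℝ≥0∞) ^ 2) ≤ ENNReal.ofReal (8 * δ ^ 2) := by
    have e : (2 * (k : ℝ≥0∞) ^ 2) = ENNReal.ofReal (2 * (k : ℝ) ^ 2) := by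
      rw [ENNReal.ofReal_mul (by norm_num), ENNReal.ofReal_pow (Nat.cast_nonneg k),
        ENNReal.ofReal_natCast]
      simp
    rw [e, ← ENNReal.ofReal_mul (by positivity)]
    refine ENNReal.ofReal_le_ofReal ?_
    have h3 := pow_le_pow_left₀ (by positivity) hkδ 2
    nlinarith
  calc ENNReal.ofReal (‖h‖ ^ 2) * ∫⁻ x in A, ENNReal.ofReal (u x ^ 2)
      ≤ ENNReal.ofReal (‖h‖ ^ 2) *
          (2 * (∫⁻ x in A, ENNReal.ofReal ((u x - u (x + (k : ℝ) • h)) ^ 2)) +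
            2 * ∫⁻ x in A, ENNReal.ofReal (u (x + (k : ℝ) • h) ^ 2)) := by
        gcongr
        rw [← lintegral_const_mul _ (by fun_prop), ← lintegral_const_mul _ (by fun_prop),
          ← lintegral_add_left (by fun_prop)]
        exact lintegral_mono fun x => ofReal_sq_le _ _
    _ ≤ ENNReal.ofReal (‖h‖ ^ 2) * (2 * ((k : ℝ≥0∞) ^ 2 * shiftEnergy Ω u h) +
            2 * ∫⁻ x in B, ENNReal.ofReal (u x ^ 2)) := by
        gcongr
        exact setLIntegral_sq_sub_le_shiftEnergy hΩ hA hu hk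
    _ = ENNReal.ofReal (‖h‖ ^ 2) * (2 * (k : ℝ≥0∞) ^ 2) * shiftEnergy Ω u h +
            2 * ENNReal.ofReal (‖h‖ ^ 2) * ∫⁻ x in B, ENNReal.ofReal (u x ^ 2) := by ring
    _ ≤ _ := by gcongr

/-! ### Cones, radial densities and Lipschitz boundaries. -/

/-- The cone of vectors `h = τ e + h'`, `h' ∈ e^⊥`, with `M |h'| ≤ τ`. -/
def cone (e : Rd d) (M : ℝ) : Set (Rd d) :=
  {h | M * ‖h - inner ℝ e h • e‖ ≤ inner ℝ e h}

theorem isClosed_cone (e : Rd d) (M : ℝ) : IsClosed (cone e M) :=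
  isClosed_le (by fun_prop) (by fun_prop)

theorem smul_mem_cone {e : Rd d} {M : ℝ} {h : Rd d} (hh : h ∈ cone e M) {s : ℝ} (hs : 0 ≤ s) :
    s • h ∈ cone e M := by
  have : s • h - inner ℝ e (s • h) • e = s • (h - inner ℝ e h • e) := by
    rw [inner_smul_right, smul_sub, mul_smul]
  simp only [cone, Set.mem_ofPred_eq] at hh ⊢
  rw [this, norm_smul, inner_smul_right, Real.norm_of_nonneg hs]
  nlinarith [mul_le_mul_of_nonneg_left hh hs]

theorem mem_cone_map_iff (R : Rd d ≃ₗᵢ[ℝ] Rd d) (e : Rd d) (M : ℝ) (h : Rd d) :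
    R h ∈ cone (R e) M ↔ h ∈ cone e M := by
  simp only [cone, Set.mem_ofPred_eq, LinearIsometryEquiv.inner_map_map]
  rw [← map_smul, ← map_sub, LinearIsometryEquiv.norm_map]

/-- The reflection in the hyperplane orthogonal to `e - w` exchanges the cones and preserves norms,
Lebesgue measure and `ν` away from `0`; at `0` the weight vanishes. -/
theorem IsRadial.setLIntegral_cone_eq {ν : Rd d → ℝ≥0∞} (hν : IsRadial ν) {e w : Rd d}
    (hew : ‖e‖ = ‖w‖) (M δ : ℝ) :
    ∫⁻ h in cone w M ∩ Metric.ball 0 δ, ENNReal.ofReal (‖h‖ ^ 2) * ν h =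
      ∫⁻ h in cone e M ∩ Metric.ball 0 δ, ENNReal.ofReal (‖h‖ ^ 2) * ν h := by
  set R : Rd d ≃ₗᵢ[ℝ] Rd d := (ℝ ∙ (e - w))ᗮ.reflection with hR
  have hRe : R e = w := Submodule.reflection_sub hew
  have hpre : R ⁻¹' (cone w M ∩ Metric.ball 0 δ) = cone e M ∩ Metric.ball 0 δ := by
    ext h
    rw [Set.mem_preimage, Set.mem_inter_iff, Set.mem_inter_iff, mem_ball_zero_iff,
      mem_ball_zero_iff, LinearIsometryEquiv.norm_map, ← hRe, mem_cone_map_iff]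
  rw [← R.measurePreserving.setLIntegral_comp_preimage_emb R.toHomeomorph.measurableEmbedding,
    hpre]
  refine lintegral_congr fun h => ?_
  rw [LinearIsometryEquiv.norm_map]
  by_cases h0 : h = 0
  · simp [h0]
  · rw [hν h (R h) h0 (LinearIsometryEquiv.norm_map R h).symm]

/-- Each unit vector is interior to the cone around it, whatever `M` is; compactness of the sphere
and homogeneity of cones finish. -/
theorem exists_finset_cone_cover (d : ℕ) (M : ℝ) :
    ∃ t : Finset (Rd d), (∀ w ∈ t, ‖w‖ = 1) ∧ ∀ h : Rd d, h ≠ 0 → ∃ w ∈ t, h ∈ cone w M := by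
  obtain ⟨t, ht, hcov⟩ := (isCompact_sphere (0 : Rd d) 1).elim_nhds_subcover (fun w => cone w M)
    fun w hw => by
      have hw1 : ‖w‖ = 1 := by simpa using hw
      have ho : IsOpen {h : Rd d | M * ‖h - inner ℝ w h • w‖ < inner ℝ w h} :=
        isOpen_lt (by fun_prop) (by fun_prop)
      refine Filter.mem_of_superset (ho.mem_nhds ?_) fun h hh => ?_
      swap
      · have hh' : M * ‖h - inner ℝ w h • w‖ < inner ℝ w h := hh
        exact hh'.le
      simp [hw1]
  refine ⟨t, fun w hw => by simpa using ht w hw, fun h hh => ?_⟩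
  have hn : 0 < ‖h‖ := norm_pos_iff.2 hh
  have hs : ‖h‖⁻¹ • h ∈ Metric.sphere (0 : Rd d) 1 := by
    rw [mem_sphere_zero_iff_norm, norm_smul, norm_inv, norm_norm, inv_mul_cancel₀ hn.ne']
  obtain ⟨w, hw, hwh⟩ := Set.mem_iUnion₂.1 (hcov hs)
  refine ⟨w, hw, ?_⟩
  have := smul_mem_cone hwh hn.le
  rwa [smul_smul, mul_inv_cancel₀ hn.ne', one_smul] at this

/-- One cone carries a fixed fraction of the integral defining `q`, uniformly in `δ`: finitely many
cones cover, and all contribute equally. -/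
theorem IsRadial.exists_setLIntegral_ball_le {ν : Rd d → ℝ≥0∞} (hν : IsRadial ν)
    {e : Rd d} (he : ‖e‖ = 1) (M : ℝ) :
    ∃ n : ℕ, ∀ δ : ℝ, ∫⁻ h in Metric.ball 0 δ, ENNReal.ofReal (‖h‖ ^ 2) * ν h ≤
      n * ∫⁻ h in cone e M ∩ Metric.ball 0 δ, ENNReal.ofReal (‖h‖ ^ 2) * ν h := by
  obtain ⟨t, ht, hcov⟩ := exists_finset_cone_cover d M
  refine ⟨t.card, fun δ => ?_⟩
  set f : Rd d → ℝ≥0∞ := fun h => ENNReal.ofReal (‖h‖ ^ 2) * ν h with hf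
  have hm : ∀ w : Rd d, MeasurableSet (cone w M ∩ Metric.ball 0 δ) := fun w =>
    (isClosed_cone w M).measurableSet.inter measurableSet_ball
  calc ∫⁻ h in Metric.ball 0 δ, f h
      ≤ ∫⁻ h in ⋃ w : t, cone (w : Rd d) M ∩ Metric.ball 0 δ, f h := by
        rw [← lintegral_indicator measurableSet_ball,
          ← lintegral_indicator (MeasurableSet.iUnion fun w : t => hm w)]
        refine lintegral_mono fun h => ?_
        by_cases h0 : h = 0
        · refine (Set.indicator_le_self _ _ _).trans ?_
          simp [hf, h0]
        by_cases hb : h ∈ Metric.ball (0 : Rd d) δ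
        · obtain ⟨w, hw, hwh⟩ := hcov h h0
          have hu : h ∈ ⋃ w : t, cone (w : Rd d) M ∩ Metric.ball 0 δ :=
            Set.mem_iUnion.2 ⟨⟨w, hw⟩, hwh, hb⟩
          rw [Set.indicator_of_mem hb, Set.indicator_of_mem hu]
        · rw [Set.indicator_of_notMem hb]
          exact zero_le
    _ ≤ ∑' w : t, ∫⁻ h in cone (w : Rd d) M ∩ Metric.ball 0 δ, f h :=
        lintegral_iUnion_le _ _
    _ = ∑' _ : t, ∫⁻ h in cone e M ∩ Metric.ball 0 δ, f h := by
        refine tsum_congr fun w => ?_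
        exact hν.setLIntegral_cone_eq (he.trans (ht w w.2).symm) M δ
    _ = _ := by
        rw [tsum_fintype, Finset.sum_const, Finset.card_univ, Fintype.card_coe, nsmul_eq_mul]

/-- Near a Lipschitz boundary point, walking along a direction of a suitable cone leads into the
interior of `Ω`. -/
theorem HasLipschitzBoundary.exists_cone {Ω : Set (Rd d)} (hL : HasLipschitzBoundary Ω)
    (hΩ : IsOpen Ω) {a : Rd d} (ha : a ∈ frontier Ω) :
    ∃ (e : Rd d) (M r : ℝ), ‖e‖ = 1 ∧ 0 < r ∧ ∀ δ : ℝ, 0 < δ → δ ≤ r → ∃ σ : ℝ, 0 < σ ∧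
      ∀ x ∈ Ω ∩ Metric.ball a r, ∀ h ∈ cone e M ∩ Metric.ball 0 δ, h ≠ 0 →
        (∀ j : ℕ, j ≤ ⌈δ / ‖h‖⌉₊ → x + (j : ℝ) • h ∈ Ω) ∧
          x + (⌈δ / ‖h‖⌉₊ : ℝ) • h ∈ innerSet Ω σ := by
  obtain ⟨r, hr, e, he, K, γ, hγ, hΩγ⟩ := hL a ha
  -- `D` is the height above the graph: positive exactly in `Ω` near `a`, Lipschitz, and growing at
  -- rate at least `1/4` along the cone.
  set D : Rd d → ℝ := fun x => inner ℝ e x - γ (x - inner ℝ e x • e) with hD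
  have hK : (0 : ℝ) ≤ K := K.2
  have hDmem : ∀ x ∈ Metric.ball a r, x ∈ Ω ↔ 0 < D x := fun x hx => by
    rw [hΩγ x hx, hD, sub_pos]
  have hsub : ∀ x y : Rd d, (y - inner ℝ e y • e) - (x - inner ℝ e x • e) =
      (y - x) - inner ℝ e (y - x) • e := fun x y => by
    rw [inner_sub_right, sub_smul]
    abel
  have hγ2 : ∀ x y : Rd d, |γ (y - inner ℝ e y • e) - γ (x - inner ℝ e x • e)| ≤
      K * ‖(y - x) - inner ℝ e (y - x) • e‖ := fun x y => by
    have := hγ.dist_le_mul (y - inner ℝ e y • e) (x - inner ℝ e x • e)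
    rwa [Real.dist_eq, dist_eq_norm, hsub] at this
  have hin : ∀ z : Rd d, |inner ℝ e z| ≤ ‖z‖ := fun z => by
    simpa [he] using abs_real_inner_le_norm e z
  have hDlip : ∀ x y : Rd d, D x - (1 + 2 * K) * ‖y - x‖ ≤ D y := fun x y => by
    have h1 := (abs_le.1 (hγ2 x y)).2
    have h2 : ‖(y - x) - inner ℝ e (y - x) • e‖ ≤ 2 * ‖y - x‖ := by
      refine (norm_sub_le _ _).trans ?_
      rw [norm_smul, he, mul_one, Real.norm_eq_abs]
      linarith [hin (y - x)]
    have h3 := (abs_le.1 (hin (y - x))).1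
    have h4 := mul_le_mul_of_nonneg_left h2 hK
    rw [inner_sub_right] at h3
    simp only [hD]
    linarith
  have hDcone : ∀ x z : Rd d, z ∈ cone e (2 * K + 1) → D x + ‖z‖ / 4 ≤ D (x + z) := fun x z hz => by
    have h1 := (abs_le.1 (hγ2 x (x + z))).2
    rw [add_sub_cancel_left] at h1
    have hz' : (2 * K + 1) * ‖z - inner ℝ e z • e‖ ≤ inner ℝ e z := hz
    have h2 : ‖z‖ ≤ ‖z - inner ℝ e z • e‖ + |inner ℝ e z| := by
      have := norm_add_le (z - inner ℝ e z • e) (inner ℝ e z • e)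
      rwa [sub_add_cancel, norm_smul, he, mul_one, Real.norm_eq_abs] at this
    have h0 := norm_nonneg (z - inner ℝ e z • e)
    have h3 := mul_nonneg hK h0
    rw [abs_of_nonneg (by nlinarith)] at h2
    have h4 : (inner ℝ e (x + z) : ℝ) = inner ℝ e x + inner ℝ e z := inner_add_right _ _ _
    simp only [hD] at h1 ⊢
    linarith
  -- Starting within `r / 8` of `a` and walking at most `2 * δ ≤ r / 4`, the chain stays within `r /
  -- 2`, where the graph description is valid with room to spare.
  refine ⟨e, 2 * K + 1, r / 8, he, by positivity, fun δ hδ hδr => ?_⟩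
  -- The walk has length at least `δ` and gains height at least `δ / 4`; moving by less than `ρ`
  -- loses at most `δ / 8` and stays in `ball a r`. So no frontier point is that close.
  set ρ : ℝ := min (δ / (8 * (1 + 2 * K))) (r / 4) with hρ
  have hρ0 : 0 < ρ := by positivity
  refine ⟨ρ / 2, by positivity, ?_⟩
  rintro x ⟨hxΩ, hxa⟩ h ⟨hcone, hball⟩ hh0
  have hn : 0 < ‖h‖ := norm_pos_iff.2 hh0
  have hhδ : ‖h‖ < δ := mem_ball_zero_iff.1 hball
  set k := ⌈δ / ‖h‖⌉₊ with hk
  have hkup : (k : ℝ) * ‖h‖ ≤ 2 * δ := by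
    have h1 : (k : ℝ) < δ / ‖h‖ + 1 := Nat.ceil_lt_add_one (by positivity)
    have h2 : (δ / ‖h‖ + 1) * ‖h‖ = δ + ‖h‖ := by field_simp
    nlinarith
  have hklow : δ ≤ (k : ℝ) * ‖h‖ := by
    have h1 : δ / ‖h‖ ≤ k := Nat.le_ceil _
    rwa [div_le_iff₀ hn] at h1
  have hnorm : ∀ j : ℕ, ‖(j : ℝ) • h‖ = j * ‖h‖ := fun j => by
    rw [norm_smul, Real.norm_of_nonneg (Nat.cast_nonneg j)]
  have hxa' : dist x a < r / 8 := hxa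
  have hjball : ∀ j : ℕ, j ≤ k → dist (x + (j : ℝ) • h) a < r / 2 := fun j hj => by
    have h1 : dist (x + (j : ℝ) • h) a ≤ dist (x + (j : ℝ) • h) x + dist x a := dist_triangle _ _ _
    have h2 : dist (x + (j : ℝ) • h) x = j * ‖h‖ := by
      rw [dist_eq_norm, add_sub_cancel_left, hnorm]
    have h3 : (j : ℝ) * ‖h‖ ≤ k * ‖h‖ := by gcongr
    linarith
  have hjD : ∀ j : ℕ, D x + j * ‖h‖ / 4 ≤ D (x + (j : ℝ) • h) := fun j => by
    have := hDcone x _ (smul_mem_cone hcone (Nat.cast_nonneg j))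
    rwa [hnorm] at this
  have hDx : 0 < D x := (hDmem x (Metric.mem_ball.2 (by linarith))).1 hxΩ
  have hjΩ : ∀ j : ℕ, j ≤ k → x + (j : ℝ) • h ∈ Ω := fun j hj => by
    refine (hDmem _ (Metric.mem_ball.2 (by linarith [hjball j hj]))).2 ?_
    have : 0 ≤ (j : ℝ) * ‖h‖ := by positivity
    linarith [hjD j]
  refine ⟨hjΩ, hjΩ k le_rfl, ?_⟩
  have hle : ρ ≤ Metric.infDist (x + (k : ℝ) • h) (frontier Ω) := by
    refine (Metric.le_infDist ⟨a, ha⟩).2 fun b hb => ?_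
    by_contra hcon
    rw [not_le] at hcon
    have hbΩ : b ∈ Ω := by
      have h1 : dist b a < r := by
        have := dist_triangle_left b a (x + (k : ℝ) • h)
        have := hjball k le_rfl
        have : ρ ≤ r / 4 := min_le_right _ _
        linarith
      refine (hDmem b h1).2 ?_
      have h2 := hDlip (x + (k : ℝ) • h) b
      rw [← dist_eq_norm, dist_comm] at h2
      have h3 : ρ ≤ δ / (8 * (1 + 2 * K)) := min_le_left _ _
      rw [le_div_iff₀ (by positivity)] at h3
      have h4 : (1 + 2 * K) * dist (x + (k : ℝ) • h) b ≤ (1 + 2 * K) * ρ := by gcongr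
      have := hjD k
      nlinarith
    exact (hΩ.frontier_eq ▸ hb).2 hbΩ
  linarith

/-! ### Patching along the frontier and the boundary estimate under `ClassA2`. -/

theorem IsSingularLevyDensity.setLIntegral_ball_lt_top {ν : Rd d → ℝ≥0∞}
    (hν : IsSingularLevyDensity ν) {δ : ℝ} (hδ : δ ≤ 1) :
    ∫⁻ h in Metric.ball 0 δ, ENNReal.ofReal (‖h‖ ^ 2) * ν h < ∞ := by
  refine lt_of_le_of_lt ?_ hν.levy
  refine le_trans (setLIntegral_mono' measurableSet_ball fun h hh => ?_)
    (setLIntegral_le_lintegral (Metric.ball 0 δ) _)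
  gcongr
  refine le_min ?_ le_rfl
  rw [mem_ball_zero_iff] at hh
  rw [← ENNReal.ofReal_one]
  refine ENNReal.ofReal_le_ofReal ?_
  have := norm_nonneg h
  nlinarith

theorem BoundaryControlled.mono {ν : Rd d → ℝ≥0∞} {Ω W W' : Set (Rd d)}
    (h : BoundaryControlled ν Ω W') (hW : W ⊆ W') : BoundaryControlled ν Ω W := fun ε hε => by
  obtain ⟨σ, hσ, C, hC⟩ := h ε hε
  exact ⟨σ, hσ, C, fun u hu =>
    (lintegral_mono_set (Set.inter_subset_inter_right _ hW)).trans (hC u hu)⟩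

theorem BoundaryControlled.union {ν : Rd d → ℝ≥0∞} {Ω W W' : Set (Rd d)}
    (h : BoundaryControlled ν Ω W) (h' : BoundaryControlled ν Ω W') :
    BoundaryControlled ν Ω (W ∪ W') := fun ε hε => by
  obtain ⟨σ, hσ, C, hC⟩ := h (ε / 2) (by simp [hε])
  obtain ⟨σ', hσ', C', hC'⟩ := h' (ε / 2) (by simp [hε])
  refine ⟨min σ σ', by positivity, C + C', fun u hu => ?_⟩
  rw [Set.inter_union_distrib_left]
  refine (lintegral_union_le _ _ _).trans ((add_le_add (hC u hu) (hC' u hu)).trans ?_)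
  have h1 := lintegral_mono_set (μ := volume) (f := fun x => ENNReal.ofReal (u x ^ 2))
    (innerSet_anti Ω (min_le_left σ σ'))
  have h2 := lintegral_mono_set (μ := volume) (f := fun x => ENNReal.ofReal (u x ^ 2))
    (innerSet_anti Ω (min_le_right σ σ'))
  refine (add_le_add (add_le_add le_rfl (mul_le_mul_right h1 _))
    (add_le_add le_rfl (mul_le_mul_right h2 _))).trans_eq ?_
  rw [ENNReal.coe_add, add_mul, add_add_add_comm, ← add_mul, ENNReal.add_halves]

theorem boundaryControlled_innerSet (ν : Rd d → ℝ≥0∞) (Ω : Set (Rd d)) {σ : ℝ} (hσ : 0 < σ) :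
    BoundaryControlled ν Ω (innerSet Ω σ) := fun ε _ => by
  refine ⟨σ, hσ, 1, fun u _ => ?_⟩
  rw [ENNReal.coe_one, one_mul]
  exact (lintegral_mono_set Set.inter_subset_right).trans le_add_self

/-- By compactness `W` contains a uniform neighbourhood of the frontier; the rest of `Ω` lies in
some `innerSet`, where the estimate is trivial. -/
theorem BoundaryControlled.of_frontier_subset {ν : Rd d → ℝ≥0∞} {Ω W : Set (Rd d)}
    (h : BoundaryControlled ν Ω W) (hd : 1 ≤ d) (hΩb : Bornology.IsBounded Ω) (hW : IsOpen W)
    (hΩW : frontier Ω ⊆ W) : BoundaryControlled ν Ω Set.univ := by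
  have hcomp : IsCompact (frontier Ω) :=
    hΩb.isCompact_closure.of_isClosed_subset isClosed_frontier frontier_subset_closure
  obtain ⟨δ, hδ, hδW⟩ := hcomp.exists_thickening_subset_open hW hΩW
  have h1 := h.union (boundaryControlled_innerSet ν Ω (half_pos hδ))
  intro ε hε
  obtain ⟨σ, hσ, C, hC⟩ := h1 ε hε
  refine ⟨σ, hσ, C, fun u hu => le_trans (lintegral_mono_set ?_) (hC u hu)⟩
  intro x hx
  refine ⟨hx.1, ?_⟩
  by_cases hxδ : Metric.infDist x (frontier Ω) < δ
  · exact Or.inl (hδW ((Metric.mem_thickening_iff_infDist_lt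
      (frontier_nonempty_of_isBounded hd hΩb ⟨x, hx.1⟩)).2 hxδ))
  · exact Or.inr ⟨hx.1, by linarith⟩

theorem ClassA2.boundaryControlled_ball {ν : Rd d → ℝ≥0∞} {Ω : Set (Rd d)} (h : ClassA2 ν Ω)
    (hΩ : IsOpen Ω) {a : Rd d} (ha : a ∈ frontier Ω) :
    ∃ r : ℝ, 0 < r ∧ BoundaryControlled ν Ω (Metric.ball a r) := by
  have hν := h.toIsSingularLevyDensity
  obtain ⟨e, M, r, he, hr, hgeo⟩ := h.lipschitz.exists_cone hΩ ha
  obtain ⟨n, hn⟩ := h.radial.exists_setLIntegral_ball_le he M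
  refine ⟨r, hr, fun ε' hε' => ?_⟩
  obtain ⟨ε, hε0, hε⟩ := ENNReal.lt_iff_exists_nnreal_btwn.1 (pos_iff_ne_zero.2 hε')
  have hε0 : 0 < ε := by exact_mod_cast hε0
  -- The `8` comes from the cost `8 * δ ^ 2` of a chain, the `n` from passing from the ball to one
  -- cone. Below, `δ ≤ 1` makes `Q` finite, so that it can be cancelled.
  have hev := h.tendsto_q.eventually (lt_mem_nhds (ENNReal.coe_lt_top (r := 8 * n / ε)))
  obtain ⟨δ, hqδ, hδ⟩ := (hev.and (Ioc_mem_nhdsGT (lt_min hr one_pos))).exists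
  have hδ0 : 0 < δ := hδ.1
  obtain ⟨σ, hσ, hmem⟩ := hgeo δ hδ0 (hδ.2.trans (min_le_left _ _))
  refine ⟨σ, hσ, 2, fun u hu => ?_⟩
  set A := Ω ∩ Metric.ball a r with hA
  set B := innerSet Ω σ with hB
  set D := cone e M ∩ Metric.ball 0 δ with hD
  have hAm : MeasurableSet A := hΩ.measurableSet.inter measurableSet_ball
  have hBm : MeasurableSet B := (isOpen_innerSet hΩ σ).measurableSet
  have hDm : MeasurableSet D := (isClosed_cone e M).measurableSet.inter measurableSet_ball
  set w := hν.aemeasurable.mk ν with hw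
  have hwm : Measurable w := hν.aemeasurable.measurable_mk
  have hwν : ν =ᵐ[volume] w := hν.aemeasurable.ae_eq_mk
  set Q := ∫⁻ h in D, ENNReal.ofReal (‖h‖ ^ 2) * w h with hQ
  have hQν : ∫⁻ h in D, ENNReal.ofReal (‖h‖ ^ 2) * ν h = Q := by
    refine lintegral_congr_ae ?_
    filter_upwards [ae_restrict_of_ae hwν] with h hh
    rw [hh]
  have hQtop : Q ≠ ∞ := by
    rw [← hQν]
    exact ((lintegral_mono_set Set.inter_subset_right).trans_lt
      (hν.setLIntegral_ball_lt_top (hδ.2.trans (min_le_right _ _)))).ne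
  have hδ2 : ENNReal.ofReal (δ ^ 2) ≠ 0 := by simp [hδ0.ne']
  have hQlow : (8 * n / ε : ℝ≥0) * ENNReal.ofReal (δ ^ 2) < n * Q := by
    refine lt_of_lt_of_le ?_ ((hn δ).trans_eq (by rw [hQν]))
    rwa [q, ENNReal.lt_div_iff_mul_lt (Or.inl hδ2) (Or.inl ENNReal.ofReal_ne_top)] at hqδ
  have hn0 : (n : ℝ≥0∞) ≠ 0 := by
    intro h0
    rw [h0, zero_mul] at hQlow
    exact not_lt_zero hQlow
  have hQ0 : Q ≠ 0 := by
    intro h0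
    rw [h0, mul_zero] at hQlow
    exact not_lt_zero hQlow
  have hQε : ENNReal.ofReal (8 * δ ^ 2) ≤ ε * Q := by
    rw [← ENNReal.mul_le_mul_iff_right hn0 (ENNReal.natCast_ne_top n)]
    calc (n : ℝ≥0∞) * ENNReal.ofReal (8 * δ ^ 2)
        = ε * ((8 * n / ε : ℝ≥0) * ENNReal.ofReal (δ ^ 2)) := by
          rw [ENNReal.ofReal_mul (by norm_num), ← mul_assoc, ← mul_assoc, ← ENNReal.coe_mul,
            mul_div_cancel₀ _ hε0.ne']
          push_cast
          simp [mul_comm]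
      _ ≤ ε * (n * Q) := by gcongr
      _ = n * (ε * Q) := by ring
  set X := ∫⁻ x in A, ENNReal.ofReal (u x ^ 2) with hX
  set Y := ∫⁻ x in B, ENNReal.ofReal (u x ^ 2) with hY
  -- Integrate the chain estimate for each jump `h` in the truncated cone against `w h`.
  have hkey : Q * X ≤ ENNReal.ofReal (8 * δ ^ 2) * energy ν Ω Ω u + 2 * Q * Y := by
    have hker := lintegral_mul_shiftEnergy_le_energy hν.aemeasurable (k := D.indicator w)
      (hwm.indicator hDm) ?_ hΩ.measurableSet hu
    swap
    · filter_upwards [hwν] with h hh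
      rw [hh]
      exact Set.indicator_le_self _ _ _
    have hker2 : ∫⁻ h, D.indicator w h * shiftEnergy Ω u h =
        ∫⁻ h in D, w h * shiftEnergy Ω u h := by
      rw [← lintegral_indicator hDm]
      refine lintegral_congr fun h => ?_
      by_cases hh : h ∈ D
      · simp [hh]
      · simp [hh]
    rw [hker2] at hker
    have hmul : Measurable fun h : Rd d => ENNReal.ofReal (‖h‖ ^ 2) * w h := by fun_prop
    calc Q * X = ∫⁻ h in D, ENNReal.ofReal (‖h‖ ^ 2) * w h * X := by
          rw [lintegral_mul_const _ hmul]
      _ ≤ ∫⁻ h in D, (ENNReal.ofReal (8 * δ ^ 2) * (w h * shiftEnergy Ω u h) +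
            ENNReal.ofReal (‖h‖ ^ 2) * w h * (2 * Y)) := by
          refine setLIntegral_mono' hDm fun h hh => ?_
          by_cases h0 : h = 0
          · simp [h0]
          have h1 := ofReal_norm_sq_mul_setLIntegral_le hΩ.measurableSet hAm hBm hu
            (mem_ball_zero_iff.1 hh.2).le h0 (fun x hx => (hmem x hx h hh h0).1)
            (fun x hx => (hmem x hx h hh h0).2)
          calc ENNReal.ofReal (‖h‖ ^ 2) * w h * X = w h * (ENNReal.ofReal (‖h‖ ^ 2) * X) := by ring
            _ ≤ w h * (ENNReal.ofReal (8 * δ ^ 2) * shiftEnergy Ω u h +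
                  2 * ENNReal.ofReal (‖h‖ ^ 2) * Y) := by gcongr
            _ = _ := by ring
      _ = ENNReal.ofReal (8 * δ ^ 2) * (∫⁻ h in D, w h * shiftEnergy Ω u h) + Q * (2 * Y) := by
          rw [lintegral_add_right _ (hmul.mul_const _), lintegral_mul_const _ hmul,
            lintegral_const_mul' _ _ ENNReal.ofReal_ne_top]
      _ ≤ ENNReal.ofReal (8 * δ ^ 2) * energy ν Ω Ω u + Q * (2 * Y) := by gcongr
      _ = _ := by ring
  rw [← ENNReal.mul_le_mul_iff_right hQ0 hQtop]
  refine hkey.trans ?_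
  calc ENNReal.ofReal (8 * δ ^ 2) * energy ν Ω Ω u + 2 * Q * Y
      ≤ ε' * Q * energy ν Ω Ω u + 2 * Q * Y := by
        gcongr
        exact hQε.trans (by gcongr)
    _ = _ := by
        push_cast
        ring

theorem ClassA2.boundaryControlled {ν : Rd d → ℝ≥0∞} {Ω : Set (Rd d)} (h : ClassA2 ν Ω)
    (hd : 1 ≤ d) (hΩ : IsOpen Ω) (hΩb : Bornology.IsBounded Ω) :
    BoundaryControlled ν Ω Set.univ := by
  have hcomp : IsCompact (frontier Ω) :=
    hΩb.isCompact_closure.of_isClosed_subset isClosed_frontier frontier_subset_closure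
  obtain ⟨W, hW, hΩW, hc⟩ : ∃ W : Set (Rd d), IsOpen W ∧ frontier Ω ⊆ W ∧
      BoundaryControlled ν Ω W := by
    -- The local estimates pass to finite unions, so compactness of the frontier makes them global.
    refine hcomp.induction_on (p := fun s => ∃ W : Set (Rd d), IsOpen W ∧ s ⊆ W ∧
      BoundaryControlled ν Ω W) ?_ ?_ ?_ ?_
    · exact ⟨∅, isOpen_empty, subset_rfl,
        (boundaryControlled_innerSet ν Ω one_pos).mono (Set.empty_subset _)⟩
    · rintro s t hst ⟨W, hW, htW, hc⟩
      exact ⟨W, hW, hst.trans htW, hc⟩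
    · rintro s t ⟨W, hW, hsW, hc⟩ ⟨W', hW', htW', hc'⟩
      exact ⟨W ∪ W', hW.union hW', Set.union_subset_union hsW htW', hc.union hc'⟩
    · intro a ha
      obtain ⟨r, hr, hc⟩ := h.boundaryControlled_ball hΩ ha
      exact ⟨Metric.ball a r, mem_nhdsWithin_of_mem_nhds (Metric.ball_mem_nhds a hr),
        Metric.ball a r, Metric.isOpen_ball, subset_rfl, hc⟩
  exact hc.of_frontier_subset hd hΩb hW hΩW

end Nonlocal

open Nonlocal in
theorem mainTheorem2 {d : ℕ} (hd : 1 ≤ d) (ν : Rd d → ℝ≥0∞) (Ω : Set (Rd d))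
    (hΩ : IsOpen Ω) (hΩb : Bornology.IsBounded Ω)
    (h : ClassA1 ν Ω ∨ ClassA2 ν Ω ∨ ClassA3 ν Ω) :
    IsCompactOperator (H.embedding ν Ω) ∧ IsCompactOperator (V.embedding ν Ω) := by
  have hH : IsCompactOperator (H.embedding ν Ω) := by
    rcases h with h | h | h
    · exact h.isCompactOperator hΩ hΩb
    · exact (h.boundaryControlled hd hΩ hΩb).isCompactOperator h.toIsSingularLevyDensity hΩ hΩb
    · exact (h.boundaryControlled hd hΩ hΩb).isCompactOperator h.toIsSingularLevyDensity hΩ hΩb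
  exact ⟨hH, V.isCompactOperator_embedding hH⟩
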